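/- **Setting.** Let $n\ge 1$ agents act in $\mathbb R^p$ (Euclidean norm $\|\cdot\|$) over iterations $t=1,2,\dots$. Let $\mathbb X\subseteq\mathbb R^p$ be closed and convex with $\|x\|\le R$ for all $x\in\mathbb X$. For $i\in[n]$, $t\ge 1$ let $f_{i,t}:\mathbb X\to\mathbb R$ be a (possibly nonconvex) loss and $g_{i,t}:\mathbb X\to\mathbb R^{m_i}$ a componentwise convex constraint function. Let $\nabla f_{i,t}(x)$ be a (Fréchet) subgradient of $f_{i,t}$ at $x$ relative to $\mathbb X$ (the gradient, when $f_{i,t}$ is differentiable), and let $\nabla g_{i,t}(x)$ be an $m_i\times p$ matrix whose rows are subgradients of the components of $g_{i,t}$ at $x$, chosen measurably in $x$. For all $i$, $t\ge1$ and $x,y\in\mathbb X$ assume $$\|\nabla f_{i,t}(x)\|\le G_1,\qquad \|\nabla g_{i,t}(x)\|\le G_2\ \text{(operator norm)},\qquad \|\nabla f_{i,t}(x)-\nabla f_{i,t}(y)\|\le L\|x-y\|.$$ Let $\nabla f_t=\frac1n\sum_{j}\nabla f_{j,t}$ and $g_t=\mathrm{col}(g_{1,t},\dots,g_{n,t})$,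 and assume that $\mathcal X_T=\{x\in\mathbb X: g_t(x)\le 0\ \ \forall t\in[T]\}$ is nonempty for every $T\ge 1$. *Network.* $\mathcal G_t=([n],\mathcal E_t)$, $t\ge1$, are directed graphs with mixing matrices $W_t$. There are $w\in(0,1)$ and an integer $B\ge1$, both independent of $t$, such that $[W_t]_{ij}\ge w$ if $(j,i)\in\mathcal E_t$ or $i=j$, and $[W_t]_{ij}=0$ otherwise; all row and column sums of $W_t$ equal $1$; and $([n],\bigcup_{l=0}^{B-1}\mathcal E_{t+l})$ is strongly connected for every $t\ge1$. *Compressor.* $\mathcal C$ is a (measurable) randomized map $\mathbb R^p\to\mathbb R^p$ with $\mathbf E\,\|\mathcal C(x)-x\|_d^2\le C$ for all $x\in\mathbb R^p$, where $d\in[1,\infty]$ and $C\ge 0$. *Algorithm.* Let $\mathcal P_{\mathbb X}$ be the Euclidean projection onto $\mathbb X$ and $[\cdot]_+$ the componentwise positive part. Start from $\hat z_{i,0}=0$ and arbitrary (deterministic) $z_{i,1}\in\mathbb X$. For $t=1,2,\dots$ and all $i,j\in[n]$ set $$\hat z_{j,t}=\mathcal P_{\mathbb X}\big(\hat z_{j,t-1}+s_t\,\mathcal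 C((z_{j,t}-\hat z_{j,t-1})/s_t)\big),\qquad x_{i,t}=\sum_{j=1}^n[W_t]_{ij}\hat z_{j,t},\qquad v_{i,t+1}=\gamma_t[g_{i,t}(x_{i,t})]_+,$$ $$\omega_{i,t+1}=\nabla f_{i,t}(x_{i,t})+\nabla g_{i,t}(x_{i,t})^{T}v_{i,t+1},\qquad z_{i,t+1}=\mathcal P_{\mathbb X}(x_{i,t}-\alpha_t\omega_{i,t+1}),$$ where the randomness of each use of $\mathcal C$ is independent of all the randomness used at earlier iterations. The parameters are $$\alpha_t=\frac{\alpha_0}{t^{\theta_1}},\qquad \gamma_t=\frac{\gamma_0}{\alpha_t},\qquad s_t=\frac{s_0}{t^{\theta_2}},$$ with constants $\theta_1\in(0,1)$, $\theta_2>\theta_1$, $\alpha_0>0$, $s_0>0$, $\gamma_0>0$ and $4G_2^2\gamma_0\le 1$. *Performance.* Let $$\mathrm{Reg}(T)=\frac1n\sum_{i=1}^n\Big(\sum_{t=1}^T\langle\nabla f_t(x_{i,t}),x_{i,t}\rangle-\inf_{x\in\mathcal X_T}\Big\langle\sum_{t=1}^T\nabla f_t(x_{i,t}),x\Big\rangle\Big),\qquad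 \mathrm{CCV}(T)=\frac1n\sum_{i=1}^n\sum_{t=1}^T\big\|[g_t(x_{i,t})]_+\big\|.$$ **Theorem 1.** There is a constant $K$, depending only on $n,p,R,G_1,G_2,L,w,B,d,C,\alpha_0,\gamma_0,s_0,\theta_1,\theta_2$, such that for every $T\ge 1$ the random variables $\mathrm{Reg}(T)$ and $\mathrm{CCV}(T)$ are integrable and $$\mathbf E[\mathrm{Reg}(T)]\le\begin{cases}K\,T^{\max\{1-\theta_1,\,1+\theta_1-\theta_2\}},&\theta_1<\theta_2<1,\\ K\,T^{\max\{1-\theta_1,\,\theta_1\}},&\theta_2\ge1,\end{cases}\qquad \mathbf E[\mathrm{CCV}(T)]\le K\,T^{1-\theta_1/2}.$$ Moreover, suppose that Slater's condition holds: for some $x_s\in\mathbb X$ and $\varsigma>0$, every component of $g_t(x_s)$ is at most $-\varsigma$ for all $t\ge1$. Then, for every $T\ge1$, $\mathbf E[\mathrm{CCV}(T)]\le K'\,T^{1-\theta_1}$ with a constant $K'$ that depends only on the quantities above and on $\varsigma$. -/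

import Mathlib

open MeasureTheory ProbabilityTheory Topology
open scoped ENNReal BigOperators

/-- `ℝ^p` with the Euclidean norm. -/
abbrev Vec (p : ℕ) : Type := EuclideanSpace ℝ (Fin p)

noncomputable section

/-- The Euclidean projection onto `K`: a minimizer over `y ∈ K` of `‖x - y‖ ^ 2`
(it exists and is unique when `K` is nonempty, closed and convex). -/
def proj {p : ℕ} (K : Set (Vec p)) (x : Vec p) : Vec p :=
  Classical.epsilon fun y => y ∈ K ∧ ∀ y' ∈ K, ‖x - y‖ ^ 2 ≤ ‖x - y'‖ ^ 2

/-- The projection `[v]₊` onto the nonnegative orthant, that is, the componentwise positive part. -/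
def orthantProj {ι : Type*} (v : EuclideanSpace ℝ ι) : EuclideanSpace ℝ ι :=
  WithLp.toLp 2 fun k => max (v k) 0

/-- The `ℓ_d` norm on `ℝ^p`, for `d ∈ [1, ∞]`. -/
def ellNorm {p : ℕ} (d : ℝ≥0∞) (x : Vec p) : ℝ :=
  ‖(WithLp.toLp d (fun k => x k) : PiLp d fun _ : Fin p => ℝ)‖

/-- `v` is a (Fréchet) subgradient at `x`, relative to `X`, of the possibly nonconvex function `φ`:
`φ y ≥ φ x + ⟪v, y - x⟫ - o(‖y - x‖)` as `y → x` in `X`. The gradient of a differentiable function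
is one, and so is every subgradient of a convex function. -/
def IsSubgradientWithinAt {p : ℕ} (φ : Vec p → ℝ) (X : Set (Vec p)) (x v : Vec p) : Prop :=
  ∀ ε > 0, ∀ᶠ y in 𝓝[X] x, φ x + inner ℝ v (y - x) - ε * ‖y - x‖ ≤ φ y

/-- The row `k` of the matrix `A` is a subgradient at `x`, over `X`, of the component `k` of the
componentwise convex map `φ`, for every `k`. -/
def IsConvexSubgradientAt {p m : ℕ} (φ : Vec p → Vec m) (X : Set (Vec p)) (x : Vec p)
    (A : Vec p →L[ℝ] Vec m) : Prop :=
  ∀ y ∈ X, ∀ k, φ x k + A (y - x) k ≤ φ y k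

/-- The data of the online problem: the decision set, the local losses `f i t`, the local
constraint functions `g i t`, and the subgradients that are revealed to the agents. Iterations are
`t = 1, 2, …`; the values at `t = 0` and outside `X` play no role. -/
structure OnlineProblem (n p : ℕ) (m : Fin n → ℕ) where
  X : Set (Vec p)
  f : Fin n → ℕ → Vec p → ℝ
  gradf : Fin n → ℕ → Vec p → Vec p
  g : (i : Fin n) → ℕ → Vec p → Vec (m i)
  gradg : (i : Fin n) → ℕ → Vec p → (Vec p →L[ℝ] Vec (m i))

/-- The time-varying directed graph with its mixing matrices; `(j, i) ∈ edges t` means that agent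
`i` receives information from agent `j` at iteration `t`. -/
structure Network (n : ℕ) where
  edges : ℕ → Set (Fin n × Fin n)
  W : ℕ → Matrix (Fin n) (Fin n) ℝ

namespace OnlineProblem

variable {n p : ℕ} {m : Fin n → ℕ} (P : OnlineProblem n p m)

/-- The (sub)gradient of the global loss `f_t = (1/n) ∑ j, f_{j,t}`. -/
def globalGrad (t : ℕ) (x : Vec p) : Vec p :=
  (1 / (n : ℝ)) • ∑ j, P.gradf j t x

/-- The global constraint function `g_t = col (g_{1,t}, …, g_{n,t})`. -/
def globalConstraint (t : ℕ) (x : Vec p) : EuclideanSpace ℝ ((i : Fin n) × Fin (m i)) :=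
  WithLp.toLp 2 fun q => P.g q.1 t x q.2

/-- The feasible set `𝒳_T`. -/
def feasibleSet (T : ℕ) : Set (Vec p) :=
  {x | x ∈ P.X ∧ ∀ t ∈ Finset.Icc 1 T, ∀ q, P.globalConstraint t x q ≤ 0}

/-- The network regret of the decisions `x i t`. -/
def netReg (x : Fin n → ℕ → Vec p) (T : ℕ) : ℝ :=
  (1 / (n : ℝ)) * ∑ i, (∑ t ∈ Finset.Icc 1 T, inner ℝ (P.globalGrad t (x i t)) (x i t)
    - sInf ((fun y => inner ℝ (∑ t ∈ Finset.Icc 1 T, P.globalGrad t (x i t)) y)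
        '' P.feasibleSet T))

/-- The network cumulative constraint violation of the decisions `x i t`. -/
def netCCV (x : Fin n → ℕ → Vec p) (T : ℕ) : ℝ :=
  (1 / (n : ℝ)) * ∑ i, ∑ t ∈ Finset.Icc 1 T, ‖orthantProj (P.globalConstraint t (x i t))‖

/-- The standing assumptions on the problem: the decision set is closed, convex and bounded by `R`;
the constraint functions are convex; the feasible sets are nonempty; the subgradients exist and are
bounded by `G₁` and `G₂` (the latter in operator norm); those of the losses are `L`-Lipschitz; the
selected subgradients of the constraints are Borel measurable on `X`. -/
structure Regular (R G₁ G₂ L : ℝ) : Prop where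
  convex : Convex ℝ P.X
  closed : IsClosed P.X
  bounded : ∀ x ∈ P.X, ‖x‖ ≤ R
  feasible : ∀ T, 1 ≤ T → (P.feasibleSet T).Nonempty
  convex_g : ∀ i t, 1 ≤ t → ∀ k, ConvexOn ℝ P.X fun x => P.g i t x k
  subgrad_f : ∀ i t, 1 ≤ t → ∀ x ∈ P.X, IsSubgradientWithinAt (P.f i t) P.X x (P.gradf i t x)
  subgrad_g : ∀ i t, 1 ≤ t → ∀ x ∈ P.X, IsConvexSubgradientAt (P.g i t) P.X x (P.gradg i t x)
  measurable_gradg : ∀ i t, 1 ≤ t → Measurable fun x : P.X => P.gradg i t x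
  gradf_le : ∀ i t, 1 ≤ t → ∀ x ∈ P.X, ‖P.gradf i t x‖ ≤ G₁
  gradg_le : ∀ i t, 1 ≤ t → ∀ x ∈ P.X, ‖P.gradg i t x‖ ≤ G₂
  gradf_lipschitz : ∀ i t, 1 ≤ t → ∀ x ∈ P.X, ∀ y ∈ P.X,
    ‖P.gradf i t x - P.gradf i t y‖ ≤ L * ‖x - y‖

/-- Slater's condition with margin `ς`. -/
def Slater (ς : ℝ) : Prop :=
  ∃ xs ∈ P.X, ∀ t, 1 ≤ t → ∀ q, P.globalConstraint t xs q ≤ -ς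

end OnlineProblem

/-- The mixing matrices are doubly stochastic, with weights at least `w` on the edges and the
diagonal and zero elsewhere, and the union of any `B` consecutive graphs is strongly connected. -/
structure Network.Regular {n : ℕ} (N : Network n) (w : ℝ) (B : ℕ) : Prop where
  weight_ge : ∀ t, 1 ≤ t → ∀ i j, ((j, i) ∈ N.edges t ∨ i = j) → w ≤ N.W t i j
  weight_eq_zero : ∀ t, 1 ≤ t → ∀ i j, ¬ ((j, i) ∈ N.edges t ∨ i = j) → N.W t i j = 0
  col_sum : ∀ t, 1 ≤ t → ∀ j, ∑ i, N.W t i j = 1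
  row_sum : ∀ t, 1 ≤ t → ∀ i, ∑ j, N.W t i j = 1
  connected : ∀ t, 1 ≤ t → ∀ i j,
    Relation.ReflTransGen (fun a b => ∃ l < B, (a, b) ∈ N.edges (t + l)) i j

/-- A randomized compressor `x ↦ Q ξ x` with internal randomness `ξ ∼ ν`, jointly measurable, whose
mean squared error in `ℓ_d` norm is at most `C` at every point. -/
structure IsCompressor {p : ℕ} {Ξ : Type*} [MeasurableSpace Ξ] (ν : Measure Ξ)
    (Q : Ξ → Vec p → Vec p) (d : ℝ≥0∞) (C : ℝ) : Prop where
  measurable : Measurable (Function.uncurry Q)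
  error_le : ∀ x, ∫⁻ ξ, ENNReal.ofReal (ellNorm d (Q ξ x - x) ^ 2) ∂ν ≤ ENNReal.ofReal C

/-- `ξ t i` is the internal randomness of the compression by agent `i` at iteration `t`: it has law
`ν` and is fresh, that is, independent of all the randomness used at earlier iterations. -/
structure IsFreshRandomness {n : ℕ} {Ω Ξ : Type*} [MeasurableSpace Ω] [MeasurableSpace Ξ]
    (μ : Measure Ω) (ν : Measure Ξ) (ξ : ℕ → Fin n → Ω → Ξ) : Prop where
  measurable : ∀ t, 1 ≤ t → ∀ i, Measurable (ξ t i)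
  law : ∀ t, 1 ≤ t → ∀ i, μ.map (ξ t i) = ν
  indep : ∀ t, 1 ≤ t → ∀ i,
    IndepFun (ξ t i) (fun ω (q : Set.Ico 1 t × Fin n) => ξ q.1 q.2 ω) μ

namespace Algorithm

variable {n p : ℕ} {m : Fin n → ℕ} {Ξ : Type*} (P : OnlineProblem n p m) (N : Network n)
  (α γ s : ℕ → ℝ) (Q : Ξ → Vec p → Vec p)

/-- The update of `ẑ_{j,t}` from `z = z_{j,t}` and `zhat = ẑ_{j,t-1}`, with compression randomness
`ξ`. -/
def updateHat (t : ℕ) (ξ : Ξ) (z zhat : Vec p) : Vec p :=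
  proj P.X (zhat + s t • Q ξ ((s t)⁻¹ • (z - zhat)))

/-- The selection of `x_{i,t}` from the vectors `ẑ_{j,t}`. -/
def select (t : ℕ) (zhat : Fin n → Vec p) (i : Fin n) : Vec p :=
  ∑ j, N.W t i j • zhat j

/-- The dual variable `v_{i,t+1}` computed at `x = x_{i,t}`. -/
def dual (t : ℕ) (i : Fin n) (x : Vec p) : Vec (m i) :=
  γ t • orthantProj (P.g i t x)

/-- The direction `ω_{i,t+1}` computed at `x = x_{i,t}`. -/
def direction (t : ℕ) (i : Fin n) (x : Vec p) : Vec p :=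
  P.gradf i t x + ContinuousLinearMap.adjoint (P.gradg i t x) (dual P γ t i x)

/-- The update `z_{i,t+1}` computed at `x = x_{i,t}`. -/
def updateZ (t : ℕ) (i : Fin n) (x : Vec p) : Vec p :=
  proj P.X (x - α t • direction P γ t i x)

/-- The pair `(z_{·,t+1}, ẑ_{·,t})` after `t` iterations, started at `z_{·,1} = z₁` and
`ẑ_{·,0} = 0`, where agent `i` uses the compression randomness `ξ t i` at iteration `t`. -/
def state (z₁ : Fin n → Vec p) (ξ : ℕ → Fin n → Ξ) :
    ℕ → (Fin n → Vec p) × (Fin n → Vec p)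
  | 0 => (z₁, 0)
  | t + 1 =>
    let zhat : Fin n → Vec p := fun j =>
      updateHat P s Q (t + 1) (ξ (t + 1) j) ((state z₁ ξ t).1 j) ((state z₁ ξ t).2 j)
    (fun i => updateZ P α γ (t + 1) i (select N (t + 1) zhat i), zhat)

/-- The decision `x_{i,t}` (for `t ≥ 1`). -/
def decision (z₁ : Fin n → Vec p) (ξ : ℕ → Fin n → Ξ) (i : Fin n) (t : ℕ) : Vec p :=
  select N t (state P N α γ s Q z₁ ξ t).2 i

end Algorithm

/-- The sequence `a₀ / t ^ θ`. -/
def powerSeq (a₀ θ : ℝ) (t : ℕ) : ℝ := a₀ / (t : ℝ) ^ θ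

end

/-!
The proof is a descent argument along each trajectory, in which the compressor enters only through
the errors `e_{i,t} = ‖ẑ_{i,t} - z_{i,t}‖`. Every pathwise bound is affine in these errors, so the
theorem follows from `𝔼 e_{i,t} ≤ s_t (1 + p C)` (`Algorithm.integral_error_le`). That estimate holds
because the projection is nonexpansive and fixes `z_{i,t}`, and because the compressed point depends
on the randomness of earlier iterations only.

Write `h_{i,t} = ‖[g_{i,t}(x_{i,t})]₊‖`. Expanding the projected step towards a comparator `y` with
`g(y) ≤ -ς` gives (`Algorithm.sq_norm_updateZ_sub_le`)
`‖z_{i,t+1} - y‖² + 2 α_t ⟪∇f_{i,t}, x_{i,t} - y⟫ + (3/2) γ₀ h² + 2 γ₀ ς h ≤ ‖x_{i,t} - y‖² + 2 α_t² G₁²`.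
Double stochasticity bounds `∑ i ‖x_{i,t} - y‖²` by `∑ i ‖z_{i,t} - y‖²` up to the errors, so the
inequality telescopes over the network. It is used in two ways.

* Unweighted, it bounds `∑ h²`, and `ς ∑ h` under Slater's condition, by `1 + ∑ α_t + ∑ e`, which is
  of order `T ^ (1 - θ₁)`. Without Slater's condition, `h ≤ τ h² + τ⁻¹` with `τ = T ^ (θ₁ / 2)`
  gives the order `T ^ (1 - θ₁ / 2)` for `∑ h`.
* Divided by `2 α_t` and summed by parts, it bounds the regret of the local losses by
  `1 / α_T + ∑ α_t + ∑ e / α_t`, minus a multiple of `∑ h² / α_t`.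

Passing from local to global quantities costs the consensus errors `∑ ‖x_{i,t} - x_{j,t}‖`. Products
of `n B` consecutive mixing matrices have entries at least `w ^ (n B)`, so they contract the diameter
of the network by a fixed factor, and summing this contraction bounds the consensus errors by the sum
of the one-step perturbations (`Network.Regular.sum_spread_le`). The step lengths are at most
`α_t G₁ + γ₀ G₂ h`. In the regret, the terms `h` arising here are absorbed by the negative terms
`h² / α_t`, at the price of a multiple of `α_t`.
-/

/-! ### Euclidean projection -/

section Projection

variable {p : ℕ} {K : Set (Vec p)}

theorem proj_spec (hne : K.Nonempty) (hcl : IsClosed K) (x : Vec p) :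
    proj K x ∈ K ∧ ∀ y ∈ K, ‖x - proj K x‖ ^ 2 ≤ ‖x - y‖ ^ 2 := by
  refine Classical.epsilon_spec
    (p := fun y => y ∈ K ∧ ∀ y' ∈ K, ‖x - y‖ ^ 2 ≤ ‖x - y'‖ ^ 2) ?_
  obtain ⟨v, hv, h⟩ := hcl.exists_infDist_eq_dist hne x
  refine ⟨v, hv, fun y hy => ?_⟩
  have := Metric.infDist_le_dist_of_mem (x := x) hy
  rw [h, dist_eq_norm, dist_eq_norm] at this
  gcongr

theorem proj_mem (hne : K.Nonempty) (hcl : IsClosed K) (x : Vec p) : proj K x ∈ K :=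
  (proj_spec hne hcl x).1

theorem proj_eq_self (hcl : IsClosed K) {x : Vec p} (hx : x ∈ K) : proj K x = x := by
  have h := (proj_spec ⟨x, hx⟩ hcl x).2 x hx
  rw [sub_self, norm_zero] at h
  have h0 : ‖x - proj K x‖ = 0 := by
    have := norm_nonneg (x - proj K x)
    nlinarith
  exact (sub_eq_zero.1 (norm_eq_zero.1 h0)).symm

theorem inner_sub_proj_le_zero (hc : Convex ℝ K) (hcl : IsClosed K) (x : Vec p) {y : Vec p}
    (hy : y ∈ K) : inner ℝ (x - proj K x) (y - proj K x) ≤ 0 := by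
  obtain ⟨hm, hle⟩ := proj_spec ⟨y, hy⟩ hcl x
  refine (norm_eq_iInf_iff_real_inner_le_zero hc hm).1 (le_antisymm ?_ ?_) y hy
  · have : Nonempty K := ⟨⟨y, hy⟩⟩
    exact le_ciInf fun w => le_of_sq_le_sq (hle w w.2) (norm_nonneg _)
  · exact ciInf_le (f := fun w : K => ‖x - w‖)
      ⟨0, by rintro _ ⟨w, rfl⟩; exact norm_nonneg _⟩ ⟨proj K x, hm⟩

theorem norm_proj_sub_proj_le (hne : K.Nonempty) (hc : Convex ℝ K) (hcl : IsClosed K)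
    (x y : Vec p) : ‖proj K x - proj K y‖ ≤ ‖x - y‖ := by
  have h1 := inner_sub_proj_le_zero hc hcl x (proj_mem hne hcl y)
  have h2 := inner_sub_proj_le_zero hc hcl y (proj_mem hne hcl x)
  have h3 : ‖proj K x - proj K y‖ ^ 2 ≤ inner ℝ (x - y) (proj K x - proj K y) := by
    rw [← real_inner_self_eq_norm_sq]
    simp only [inner_sub_left, inner_sub_right] at *
    rw [real_inner_comm (proj K x) (proj K y)] at *
    linarith
  have h4 := real_inner_le_norm (x - y) (proj K x - proj K y)
  by_contra! h
  nlinarith [norm_nonneg (x - y)]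

theorem norm_proj_sub_le (hc : Convex ℝ K) (hcl : IsClosed K) (x : Vec p) {y : Vec p}
    (hy : y ∈ K) : ‖proj K x - y‖ ≤ ‖x - y‖ := by
  simpa only [proj_eq_self hcl hy] using norm_proj_sub_proj_le ⟨y, hy⟩ hc hcl x y

theorem continuous_proj (hne : K.Nonempty) (hc : Convex ℝ K) (hcl : IsClosed K) :
    Continuous (proj K) :=
  (LipschitzWith.of_dist_le_mul (K := 1) fun x y => by
    simpa [dist_eq_norm] using norm_proj_sub_proj_le hne hc hcl x y).continuous

end Projection

/-! ### Contraction of averaging over the network -/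

section Consensus

variable {n : ℕ} {E : Type*} [NormedAddCommGroup E]

/-- The diameter of a finite family of vectors. -/
noncomputable def spread (u : Fin n → E) : ℝ := ⨆ q : Fin n × Fin n, ‖u q.1 - u q.2‖

theorem norm_sub_le_spread (u : Fin n → E) (i j : Fin n) : ‖u i - u j‖ ≤ spread u :=
  le_ciSup (f := fun q : Fin n × Fin n => ‖u q.1 - u q.2‖) (Set.finite_range _).bddAbove (i, j)

theorem spread_nonneg (u : Fin n → E) : 0 ≤ spread u :=
  Real.iSup_nonneg fun _ => norm_nonneg _

theorem spread_le {u : Fin n → E} {c : ℝ} (hc : 0 ≤ c) (h : ∀ i j, ‖u i - u j‖ ≤ c) :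
    spread u ≤ c :=
  Real.iSup_le (fun q => h q.1 q.2) hc

theorem spread_le_add {u v : Fin n → E} {c : ℝ} (hc : 0 ≤ c) (h : ∀ i, ‖u i - v i‖ ≤ c) :
    spread u ≤ spread v + 2 * c := by
  refine spread_le (by linarith [spread_nonneg v]) fun i j => ?_
  calc ‖u i - u j‖ = ‖(v i - v j) + ((u i - v i) - (u j - v j))‖ := by congr 1; abel
    _ ≤ ‖v i - v j‖ + (‖u i - v i‖ + ‖u j - v j‖) :=
      (norm_add_le _ _).trans (add_le_add_right (norm_sub_le _ _) _)
    _ ≤ spread v + 2 * c := by linarith [norm_sub_le_spread v i j, h i, h j]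

variable [NormedSpace ℝ E]

theorem norm_average_sub_le {a : Fin n → ℝ} (ha : ∀ j, 0 ≤ a j) (h1 : ∑ j, a j = 1)
    (u : Fin n → E) (y : E) : ‖∑ j, a j • u j - y‖ ≤ ∑ j, a j * ‖u j - y‖ := by
  have : ∑ j, a j • u j - y = ∑ j, a j • (u j - y) := by
    simp only [smul_sub, Finset.sum_sub_distrib, ← Finset.sum_smul, h1, one_smul]
  rw [this]
  refine (norm_sum_le _ _).trans (Finset.sum_le_sum fun j _ => ?_)
  rw [norm_smul, Real.norm_of_nonneg (ha j)]

/-- A stochastic matrix with all entries at least `η` contracts diameters by the factor `1 - η`. -/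
theorem spread_average_le {M : Matrix (Fin n) (Fin n) ℝ} {η : ℝ} (hM : ∀ i j, η ≤ M i j)
    (hη : 0 ≤ η) (h1 : ∀ i, ∑ j, M i j = 1) (u : Fin n → E) :
    spread (fun i => ∑ j, M i j • u j) ≤ (1 - η) * spread u := by
  have hM0 : ∀ i j, 0 ≤ M i j := fun i j => hη.trans (hM i j)
  have key : ∀ i k, ‖∑ j, M i j • u j - u k‖ ≤ (1 - η) * spread u := by
    intro i k
    calc ‖∑ j, M i j • u j - u k‖ ≤ ∑ j, M i j * ‖u j - u k‖ := norm_average_sub_le (hM0 i) (h1 i) u _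
      _ = ∑ j ∈ Finset.univ.erase k, M i j * ‖u j - u k‖ := by
        rw [← Finset.add_sum_erase _ _ (Finset.mem_univ k)]; simp
      _ ≤ ∑ j ∈ Finset.univ.erase k, M i j * spread u :=
        Finset.sum_le_sum fun j _ => mul_le_mul_of_nonneg_left (norm_sub_le_spread u j k) (hM0 i j)
      _ = (1 - M i k) * spread u := by
        rw [← Finset.sum_mul, Finset.sum_erase_eq_sub (Finset.mem_univ k), h1]
      _ ≤ (1 - η) * spread u :=
        mul_le_mul_of_nonneg_right (by linarith [hM i k]) (spread_nonneg u)
  rcases isEmpty_or_nonempty (Fin n) with hE | ⟨⟨k⟩⟩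
  · simp [spread]
  refine spread_le ((norm_nonneg _).trans (key k k)) fun i j => ?_
  refine (norm_average_sub_le (hM0 i) (h1 i) u _).trans ?_
  calc ∑ k, M i k * ‖u k - ∑ j', M j j' • u j'‖ ≤ ∑ k, M i k * ((1 - η) * spread u) :=
        Finset.sum_le_sum fun k _ => mul_le_mul_of_nonneg_left
          (by rw [norm_sub_rev]; exact key j k) (hM0 i k)
    _ = (1 - η) * spread u := by rw [← Finset.sum_mul, h1, one_mul]

/-- The product `W (t + k - 1) * ⋯ * W t` of `k` consecutive mixing matrices. -/
def transition (W : ℕ → Matrix (Fin n) (Fin n) ℝ) (t : ℕ) : ℕ → Matrix (Fin n) (Fin n) ℝ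
  | 0 => 1
  | k + 1 => W (t + k) * transition W t k

theorem transition_nonneg {W : ℕ → Matrix (Fin n) (Fin n) ℝ} {t : ℕ}
    (hW : ∀ r, t ≤ r → ∀ i j, 0 ≤ W r i j) (k : ℕ) (i j : Fin n) :
    0 ≤ transition W t k i j := by
  induction k generalizing i with
  | zero => rw [transition, Matrix.one_apply]; split_ifs <;> norm_num
  | succ k ih =>
    rw [transition, Matrix.mul_apply]
    exact Finset.sum_nonneg fun a _ => mul_nonneg (hW _ (Nat.le_add_right _ _) _ _) (ih a)

theorem transition_row_sum {W : ℕ → Matrix (Fin n) (Fin n) ℝ} {t : ℕ}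
    (hW : ∀ r, t ≤ r → ∀ i, ∑ j, W r i j = 1) (k : ℕ) (i : Fin n) :
    ∑ j, transition W t k i j = 1 := by
  induction k generalizing i with
  | zero => simp [transition, Matrix.one_apply]
  | succ k ih =>
    simp only [transition, Matrix.mul_apply]
    rw [Finset.sum_comm]
    simp only [← Finset.mul_sum, ih, mul_one]
    exact hW _ (Nat.le_add_right _ _) _

/-- Averaging does not amplify perturbations, so those of `k` consecutive steps merely add up. -/
theorem norm_sub_transition_le {W : ℕ → Matrix (Fin n) (Fin n) ℝ} {t : ℕ}
    (hW0 : ∀ r, t ≤ r → ∀ i j, 0 ≤ W r i j) (hW1 : ∀ r, t ≤ r → ∀ i, ∑ j, W r i j = 1)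
    {u : ℕ → Fin n → E} {b : ℕ → ℝ}
    (hu : ∀ r, t ≤ r → ∀ i, ‖u (r + 1) i - ∑ j, W r i j • u r j‖ ≤ b r) (k : ℕ) (i : Fin n) :
    ‖u (t + k) i - ∑ j, transition W t k i j • u t j‖ ≤ ∑ l ∈ Finset.range k, b (t + l) := by
  induction k generalizing i with
  | zero => simp [transition, Matrix.one_apply]
  | succ k ih =>
    have hk : t ≤ t + k := Nat.le_add_right _ _
    have h2 : ∑ j, transition W t (k + 1) i j • u t j
        = ∑ a, W (t + k) i a • ∑ j, transition W t k a j • u t j := by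
      simp only [transition, Matrix.mul_apply, Finset.sum_smul, Finset.smul_sum, mul_smul]
      exact Finset.sum_comm
    have h3 : u (t + (k + 1)) i - ∑ j, transition W t (k + 1) i j • u t j
        = (u (t + k + 1) i - ∑ a, W (t + k) i a • u (t + k) a)
          + ∑ a, W (t + k) i a • (u (t + k) a - ∑ j, transition W t k a j • u t j) := by
      rw [h2]
      simp only [smul_sub, Finset.sum_sub_distrib, add_assoc]
      abel
    rw [h3, Finset.sum_range_succ, add_comm (Finset.sum _ _)]
    refine (norm_add_le _ _).trans (add_le_add (hu _ hk i) ?_)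
    calc ‖∑ a, W (t + k) i a • (u (t + k) a - ∑ j, transition W t k a j • u t j)‖
        ≤ ∑ a, W (t + k) i a * ∑ l ∈ Finset.range k, b (t + l) := by
          refine (norm_sum_le _ _).trans (Finset.sum_le_sum fun a _ => ?_)
          rw [norm_smul, Real.norm_of_nonneg (hW0 _ hk i a)]
          exact mul_le_mul_of_nonneg_left (ih a) (hW0 _ hk i a)
      _ = ∑ l ∈ Finset.range k, b (t + l) := by rw [← Finset.sum_mul, hW1 _ hk, one_mul]

end Consensus

section Network

variable {n : ℕ} {N : Network n} {w : ℝ} {B : ℕ}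

theorem Network.Regular.weight_nonneg (hN : N.Regular w B) (hw : 0 < w) {t : ℕ} (ht : 1 ≤ t)
    (i j : Fin n) : 0 ≤ N.W t i j := by
  by_cases h : (j, i) ∈ N.edges t ∨ i = j
  · exact hw.le.trans (hN.weight_ge t ht i j h)
  · exact (hN.weight_eq_zero t ht i j h).ge

/-- If the information of agent `j` has reached `a` with weight `w ^ k` after `k` steps, and `a`
sends to `i` in the next one, then it reaches `i` with weight `w ^ (k + 1)`. -/
theorem Network.Regular.transition_step (hN : N.Regular w B) (hw : 0 < w) {t : ℕ} (ht : 1 ≤ t)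
    {k : ℕ} {a i j : Fin n} (ha : w ^ k ≤ transition N.W t k a j)
    (hai : (a, i) ∈ N.edges (t + k) ∨ i = a) : w ^ (k + 1) ≤ transition N.W t (k + 1) i j := by
  have h0 : ∀ b, 0 ≤ N.W (t + k) i b * transition N.W t k b j := fun b =>
    mul_nonneg (hN.weight_nonneg hw (by lia) _ _)
      (transition_nonneg (fun r hr => hN.weight_nonneg hw (ht.trans hr)) k b j)
  rw [transition, Matrix.mul_apply, pow_succ']
  calc w * w ^ k ≤ N.W (t + k) i a * transition N.W t k a j :=
        mul_le_mul (hN.weight_ge _ (by lia) _ _ hai) ha (by positivity)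
          (hN.weight_nonneg hw (by lia) _ _)
    _ ≤ _ := Finset.single_le_sum (f := fun b => N.W (t + k) i b * transition N.W t k b j)
        (fun b _ => h0 b) (Finset.mem_univ a)

open Classical in
/-- The set of agents reached from `j` with weight `w ^ k` gains a member in every window of length
`B` until it is everything, by strong connectivity. -/
theorem Network.Regular.card_reached_ge (hN : N.Regular w B) (hw : 0 < w) {t : ℕ} (ht : 1 ≤ t)
    (j : Fin n) (q : ℕ) :
    min n (q + 1)
      ≤ (Finset.univ.filter fun i => w ^ (q * B) ≤ transition N.W t (q * B) i j).card := by
  set S : ℕ → Finset (Fin n) := fun k =>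
    Finset.univ.filter fun i => w ^ k ≤ transition N.W t k i j with hS
  have hmono : Monotone S := monotone_nat_of_le_succ fun k i hi => by
    simp only [hS, Finset.mem_filter, Finset.mem_univ, true_and] at hi ⊢
    exact hN.transition_step hw ht hi (Or.inr rfl)
  have hj : j ∈ S 0 := by simp [hS, transition]
  change min n (q + 1) ≤ (S (q * B)).card
  induction q with
  | zero =>
    rw [zero_mul]
    exact (min_le_right _ _).trans (Finset.card_pos.2 ⟨j, hj⟩)
  | succ q ih =>
    have hsub : S (q * B) ⊆ S ((q + 1) * B) := hmono (by rw [add_mul]; lia)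
    by_cases heq : S (q * B) = S ((q + 1) * B)
    · have hall : ∀ i, i ∈ S (q * B) := by
        intro i
        have hconn := hN.connected (t + q * B) (by lia) j i
        induction hconn with
        | refl => exact hmono (Nat.zero_le _) hj
        | @tail b c _ hbc hb =>
          obtain ⟨l, hl, he⟩ := hbc
          have hb' := hmono (Nat.le_add_right (q * B) l) hb
          have hc : c ∈ S (q * B + l + 1) := by
            simp only [hS, Finset.mem_filter, Finset.mem_univ, true_and] at hb' ⊢
            exact hN.transition_step hw ht hb' (Or.inl (by rwa [← add_assoc]))
          rw [heq]
          exact hmono (by rw [add_mul, one_mul]; lia) hc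
      have : S ((q + 1) * B) = Finset.univ := by
        rw [← heq]; exact Finset.eq_univ_iff_forall.2 hall
      rw [this, Finset.card_univ, Fintype.card_fin]
      exact min_le_left _ _
    · have := Finset.card_lt_card (hsub.ssubset_of_ne heq)
      lia

theorem Network.Regular.pow_le_transition (hN : N.Regular w B) (hw : 0 < w) {t : ℕ} (ht : 1 ≤ t)
    (i j : Fin n) : w ^ (n * B) ≤ transition N.W t (n * B) i j := by
  classical
  have h := hN.card_reached_ge hw ht j n
  have h2 := (Finset.card_eq_iff_eq_univ _).1
    (le_antisymm (Finset.card_le_univ _) (by rw [Fintype.card_fin]; exact (by lia : n ≤ _).trans h))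
  simpa using Finset.eq_univ_iff_forall.1 h2 i

/-- The consensus estimate: the diameters of a perturbed averaging process sum up to a multiple of
the sum of the perturbations. -/
theorem Network.Regular.sum_spread_le (hN : N.Regular w B) (hw : 0 < w) {E : Type*}
    [NormedAddCommGroup E] [NormedSpace ℝ E] {u : ℕ → Fin n → E} {b : ℕ → ℝ} {D : ℝ}
    (hu : ∀ t, 1 ≤ t → ∀ i, ‖u (t + 1) i - ∑ j, N.W t i j • u t j‖ ≤ b t)
    (hb : ∀ t, 1 ≤ t → 0 ≤ b t) (hD : ∀ t, 1 ≤ t → spread (u t) ≤ D) (T : ℕ) :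
    w ^ (n * B) * ∑ t ∈ Finset.Icc 1 T, spread (u t)
      ≤ (n * B : ℕ) * (D + 2 * ∑ t ∈ Finset.Icc 1 T, b t) := by
  set M := n * B with hM
  set η := w ^ M with hη
  have hη0 : 0 ≤ η := by positivity
  have hD0 : 0 ≤ D := (spread_nonneg _).trans (hD 1 le_rfl)
  have hstep : ∀ t, 1 ≤ t → spread (u (t + M))
      ≤ (1 - η) * spread (u t) + 2 * ∑ l ∈ Finset.range M, b (t + l) := by
    intro t ht
    have h1 := norm_sub_transition_le (W := N.W) (t := t)
      (fun r hr => hN.weight_nonneg hw (ht.trans hr)) (fun r hr => hN.row_sum r (ht.trans hr))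
      (u := u) (b := b) (fun r hr => hu r (ht.trans hr)) M
    refine (spread_le_add (Finset.sum_nonneg fun l _ => hb _ (by lia)) h1).trans ?_
    gcongr
    exact spread_average_le (hN.pow_le_transition hw ht) hη0
      (transition_row_sum (fun r hr => hN.row_sum r (ht.trans hr)) _) _
  have hbs : 0 ≤ ∑ t ∈ Finset.Icc 1 T, b t :=
    Finset.sum_nonneg fun t ht => hb t (Finset.mem_Icc.1 ht).1
  -- The first `M` diameters are bounded by `D`, the others by the contraction over `M` steps.
  have hη1 : η * ∑ t ∈ Finset.Icc 1 T, spread (u t) ≤ ∑ t ∈ Finset.Icc 1 T, spread (u t) -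
      (1 - η) * ∑ t ∈ Finset.Icc 1 T, spread (u t) := by linarith
  have hrest : ∑ t ∈ Finset.Icc 1 T, spread (u t) ≤ M * D + ((1 - η) *
      ∑ t ∈ Finset.Icc 1 T, spread (u t) + 2 * (M * ∑ t ∈ Finset.Icc 1 T, b t)) := by
    have hsplit : ∑ t ∈ Finset.Icc 1 T, spread (u t)
        ≤ ∑ t ∈ Finset.Icc 1 M, spread (u t) + ∑ t ∈ Finset.Icc 1 (T - M), spread (u (t + M)) := by
      have hinj : ∑ t ∈ Finset.Icc 1 (T - M), spread (u (t + M))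
          = ∑ t ∈ (Finset.Icc 1 (T - M)).image (· + M), spread (u t) := by
        rw [Finset.sum_image fun a _ b _ h => by simpa using h]
      rw [hinj]
      have hsub : Finset.Icc 1 T ⊆ Finset.Icc 1 M ∪ (Finset.Icc 1 (T - M)).image (· + M) := by
        intro t ht
        rw [Finset.mem_Icc] at ht
        rw [Finset.mem_union, Finset.mem_Icc, Finset.mem_image]
        by_cases h : t ≤ M
        · exact Or.inl ⟨ht.1, h⟩
        · exact Or.inr ⟨t - M, by rw [Finset.mem_Icc]; lia, by lia⟩
      refine (Finset.sum_le_sum_of_subset_of_nonneg hsub fun _ _ _ => spread_nonneg _).trans ?_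
      rw [← Finset.sum_union_inter]
      linarith [Finset.sum_nonneg (s := Finset.Icc 1 M ∩ (Finset.Icc 1 (T - M)).image (· + M))
        fun t _ => spread_nonneg (u t)]
    have h1 : ∑ t ∈ Finset.Icc 1 M, spread (u t) ≤ M * D := by
      refine (Finset.sum_le_card_nsmul _ _ D fun t ht => hD t (Finset.mem_Icc.1 ht).1).trans ?_
      simp
    have h1η : 0 ≤ 1 - η ∨ n = 0 := by
      rcases Nat.eq_zero_or_pos n with h | h
      · exact Or.inr h
      · left
        have e1 := hN.pow_le_transition hw le_rfl ⟨0, h⟩ ⟨0, h⟩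
        have e2 := transition_row_sum (W := N.W) (t := 1) (fun r hr => hN.row_sum r hr) M ⟨0, h⟩
        have e3 := Finset.single_le_sum (f := fun j => transition N.W 1 M ⟨0, h⟩ j)
          (fun j _ => transition_nonneg (fun r hr => hN.weight_nonneg hw hr) M ⟨0, h⟩ j)
          (Finset.mem_univ ⟨0, h⟩)
        linarith
    rcases h1η with h1η | h0
    swap
    · subst h0
      simp [spread, hM]
    have h2 : ∑ t ∈ Finset.Icc 1 (T - M), spread (u (t + M))
        ≤ (1 - η) * ∑ t ∈ Finset.Icc 1 T, spread (u t) + 2 * (M * ∑ t ∈ Finset.Icc 1 T, b t) := by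
      refine (Finset.sum_le_sum fun t ht => hstep t (Finset.mem_Icc.1 ht).1).trans ?_
      rw [Finset.sum_add_distrib, ← Finset.mul_sum, ← Finset.mul_sum, Finset.sum_comm]
      refine add_le_add (mul_le_mul_of_nonneg_left ?_ h1η) (mul_le_mul_of_nonneg_left ?_ two_pos.le)
      · exact Finset.sum_le_sum_of_subset_of_nonneg
          (Finset.Icc_subset_Icc_right (Nat.sub_le _ _)) fun _ _ _ => spread_nonneg _
      · refine (Finset.sum_le_card_nsmul _ _ (∑ t ∈ Finset.Icc 1 T, b t) fun l hl => ?_).trans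
          (by simp)
        have hinj : ∑ t ∈ Finset.Icc 1 (T - M), b (t + l)
            = ∑ t ∈ (Finset.Icc 1 (T - M)).image (· + l), b t := by
          rw [Finset.sum_image fun a _ b _ h => by simpa using h]
        rw [hinj]
        refine Finset.sum_le_sum_of_subset_of_nonneg ?_ fun t ht _ => hb t (Finset.mem_Icc.1 ht).1
        intro t ht
        obtain ⟨r, hr, rfl⟩ := Finset.mem_image.1 ht
        rw [Finset.mem_Icc] at hr ⊢
        rw [Finset.mem_range] at hl
        lia
    linarith
  linarith

end Network

/-! ### Power sums -/

theorem sum_rpow_neg_le {a : ℝ} (ha0 : 0 ≤ a) (ha1 : a < 1) (T : ℕ) :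
    ∑ t ∈ Finset.Icc 1 T, (t : ℝ) ^ (-a) ≤ (T : ℝ) ^ (1 - a) / (1 - a) := by
  have h1 : 0 < 1 - a := by linarith
  rw [le_div_iff₀ h1]
  induction T with
  | zero => simp [Real.zero_rpow h1.ne']
  | succ T ih =>
    rw [Finset.sum_Icc_succ_top (by lia), add_mul]
    have hT : (0 : ℝ) < (T + 1 : ℕ) := by positivity
    -- Concavity of `x ^ (1 - a)`, compared with its tangent at `T + 1`.
    have hb := rpow_one_add_le_one_add_mul_self (s := -1 / ((T + 1 : ℕ) : ℝ)) (p := 1 - a)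
      (by rw [le_div_iff₀ hT]; push_cast; linarith [T.cast_nonneg (α := ℝ)]) h1.le (by linarith)
    have hq : (T : ℝ) = (T + 1 : ℕ) * (1 + -1 / ((T + 1 : ℕ) : ℝ)) := by
      field_simp; push_cast; ring
    have hle : (T : ℝ) ^ (1 - a)
        ≤ ((T + 1 : ℕ) : ℝ) ^ (1 - a) - (1 - a) * ((T + 1 : ℕ) : ℝ) ^ (-a) := by
      have hnn : 0 ≤ 1 + -1 / ((T + 1 : ℕ) : ℝ) := by
        have : (0 : ℝ) ≤ (T + 1 : ℕ) * (1 + -1 / ((T + 1 : ℕ) : ℝ)) := by rw [← hq]; positivity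
        exact nonneg_of_mul_nonneg_right this hT
      calc (T : ℝ) ^ (1 - a)
          = ((T + 1 : ℕ) : ℝ) ^ (1 - a) * (1 + -1 / ((T + 1 : ℕ) : ℝ)) ^ (1 - a) := by
            rw [← Real.mul_rpow hT.le hnn, ← hq]
        _ ≤ ((T + 1 : ℕ) : ℝ) ^ (1 - a) * (1 + (1 - a) * (-1 / ((T + 1 : ℕ) : ℝ))) := by gcongr
        _ = _ := by
          have : ((T + 1 : ℕ) : ℝ) ^ (-a) = ((T + 1 : ℕ) : ℝ) ^ (1 - a) / ((T + 1 : ℕ) : ℝ) := by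
            rw [show -a = (1 - a) - 1 by ring, Real.rpow_sub_one hT.ne']
          rw [this]; field_simp; ring
    linarith

/-! ### One step of the algorithm -/

section Orthant

variable {ι : Type*}

theorem orthantProj_apply (v : EuclideanSpace ℝ ι) (k : ι) : orthantProj v k = max (v k) 0 := rfl

variable [Fintype ι]

theorem norm_le_of_abs_le {u v : EuclideanSpace ℝ ι} (h : ∀ k, |u k| ≤ v k) : ‖u‖ ≤ ‖v‖ := by
  rw [EuclideanSpace.norm_eq, EuclideanSpace.norm_eq]
  refine Real.sqrt_le_sqrt (Finset.sum_le_sum fun k _ => ?_)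
  rw [Real.norm_eq_abs, Real.norm_eq_abs]
  exact pow_le_pow_left₀ (abs_nonneg _) ((h k).trans (le_abs_self _)) 2

theorem norm_sq_orthantProj (v : EuclideanSpace ℝ ι) :
    ‖orthantProj v‖ ^ 2 = ∑ k, max (v k) 0 ^ 2 := by
  rw [EuclideanSpace.norm_sq_eq]
  simp [orthantProj_apply]

theorem norm_orthantProj_le_sum (v : EuclideanSpace ℝ ι) :
    ‖orthantProj v‖ ≤ ∑ k, max (v k) 0 := by
  refine le_of_sq_le_sq ?_ (Finset.sum_nonneg fun _ _ => le_max_right _ _)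
  rw [norm_sq_orthantProj]
  exact Finset.sum_sq_le_sq_sum_of_nonneg fun _ _ => le_max_right _ _

/-- If every component of `v` exceeds that of `u` by at most that of `d`, then testing `d` against
`[v]₊` bounds the squared norm of `[v]₊`; a margin `ς` in `u` adds a linear term. -/
theorem sq_norm_orthantProj_add_le_inner {u v d : EuclideanSpace ℝ ι} {ς : ℝ} (hς : 0 ≤ ς)
    (hd : ∀ k, v k - d k ≤ u k) (hu : ∀ k, u k ≤ -ς) :
    ‖orthantProj v‖ ^ 2 + ς * ‖orthantProj v‖ ≤ inner ℝ (orthantProj v) d := by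
  have h1 : inner ℝ (orthantProj v) d = ∑ k, max (v k) 0 * d k := by
    rw [PiLp.inner_apply]
    exact Finset.sum_congr rfl fun k _ => by simp [orthantProj_apply, mul_comm]
  calc ‖orthantProj v‖ ^ 2 + ς * ‖orthantProj v‖
      ≤ ∑ k, max (v k) 0 ^ 2 + ς * ∑ k, max (v k) 0 := by
        rw [norm_sq_orthantProj]
        gcongr
        exact norm_orthantProj_le_sum v
    _ = ∑ k, max (v k) 0 * (max (v k) 0 + ς) := by
        rw [Finset.mul_sum, ← Finset.sum_add_distrib]
        exact Finset.sum_congr rfl fun k _ => by ring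
    _ ≤ _ := by
        rw [h1]
        refine Finset.sum_le_sum fun k _ => ?_
        rcases le_total (v k) 0 with h | h
        · simp [max_eq_right h]
        · rw [max_eq_left h]
          exact mul_le_mul_of_nonneg_left (by linarith [hd k, hu k]) h

end Orthant

namespace OnlineProblem

variable {n p : ℕ} {m : Fin n → ℕ} {P : OnlineProblem n p m} {R G₁ G₂ L : ℝ}

/-- The violation `‖[g_{i,t}(x)]₊‖` of the constraints of agent `i`. -/
noncomputable def violation (P : OnlineProblem n p m) (i : Fin n) (t : ℕ) (x : Vec p) : ℝ :=
  ‖orthantProj (P.g i t x)‖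

theorem violation_nonneg (i : Fin n) (t : ℕ) (x : Vec p) : 0 ≤ P.violation i t x := norm_nonneg _

theorem Regular.nonempty (hP : P.Regular R G₁ G₂ L) : P.X.Nonempty :=
  (hP.feasible 1 le_rfl).mono fun _ hx => hx.1

theorem Regular.radius_nonneg (hP : P.Regular R G₁ G₂ L) : 0 ≤ R := by
  obtain ⟨x, hx⟩ := hP.nonempty
  exact (norm_nonneg _).trans (hP.bounded x hx)

theorem Regular.gradf_bound_nonneg (hP : P.Regular R G₁ G₂ L) (i : Fin n) : 0 ≤ G₁ := by
  obtain ⟨x, hx⟩ := hP.nonempty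
  exact (norm_nonneg _).trans (hP.gradf_le i 1 le_rfl x hx)

theorem Regular.gradg_bound_nonneg (hP : P.Regular R G₁ G₂ L) (i : Fin n) : 0 ≤ G₂ := by
  obtain ⟨x, hx⟩ := hP.nonempty
  exact (norm_nonneg _).trans (hP.gradg_le i 1 le_rfl x hx)

theorem Regular.norm_sub_le_two_mul (hP : P.Regular R G₁ G₂ L) {x y : Vec p} (hx : x ∈ P.X)
    (hy : y ∈ P.X) : ‖x - y‖ ≤ 2 * R := by
  linarith [norm_sub_le x y, hP.bounded x hx, hP.bounded y hy]

theorem Regular.violation_le (hP : P.Regular R G₁ G₂ L) {i : Fin n} {t : ℕ} (ht : 1 ≤ t)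
    {x y : Vec p} (hx : x ∈ P.X) (hy : y ∈ P.X) :
    P.violation i t x ≤ P.violation i t y + G₂ * ‖x - y‖ := by
  set A := P.gradg i t x
  set d : Vec (m i) := WithLp.toLp 2 fun k => |A (x - y) k| with hd
  have hdn : ‖d‖ ≤ G₂ * ‖x - y‖ := by
    have : ‖d‖ = ‖A (x - y)‖ := by simp [EuclideanSpace.norm_eq, hd]
    rw [this]
    exact (A.le_opNorm _).trans
      (mul_le_mul_of_nonneg_right (hP.gradg_le i t ht x hx) (norm_nonneg _))
  have hle : ‖orthantProj (P.g i t x)‖ ≤ ‖orthantProj (P.g i t y) + d‖ := by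
    refine norm_le_of_abs_le fun k => ?_
    have h1 := hP.subgrad_g i t ht x hx y hy k
    have h2 : A (y - x) k = -(A (x - y) k) := by
      rw [← neg_sub x y, map_neg]; rfl
    change P.g i t x k + A (y - x) k ≤ _ at h1
    rw [orthantProj_apply, abs_of_nonneg (le_max_right _ _), PiLp.add_apply, orthantProj_apply]
    have h3 : d k = |A (x - y) k| := rfl
    rw [h3]
    refine max_le ?_ (add_nonneg (le_max_right _ _) (abs_nonneg _))
    linarith [le_max_left (P.g i t y k) 0, le_abs_self (A (x - y) k)]
  exact hle.trans ((norm_add_le _ _).trans (add_le_add_right hdn _))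

theorem norm_orthantProj_globalConstraint_le (t : ℕ) (x : Vec p) :
    ‖orthantProj (P.globalConstraint t x)‖ ≤ ∑ j, P.violation j t x := by
  refine le_of_sq_le_sq ?_ (Finset.sum_nonneg fun _ _ => violation_nonneg _ _ _)
  rw [norm_sq_orthantProj, Fintype.sum_sigma]
  calc _ = ∑ j, P.violation j t x ^ 2 :=
        Finset.sum_congr rfl fun j _ => by
          rw [violation, norm_sq_orthantProj]; rfl
    _ ≤ _ := Finset.sum_sq_le_sq_sum_of_nonneg fun _ _ => violation_nonneg _ _ _

end OnlineProblem

namespace Algorithm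

variable {n p : ℕ} {m : Fin n → ℕ} {P : OnlineProblem n p m} {R G₁ G₂ L γ₀ : ℝ} {α γ : ℕ → ℝ}

theorem norm_smul_direction_le (hP : P.Regular R G₁ G₂ L) (hγ₀ : 0 ≤ γ₀) {t : ℕ} (ht : 1 ≤ t)
    (hα : 0 < α t) (hγ : γ t = γ₀ / α t) (i : Fin n) {x : Vec p} (hx : x ∈ P.X) :
    ‖α t • direction P γ t i x‖ ≤ α t * G₁ + γ₀ * G₂ * P.violation i t x := by
  rw [norm_smul, Real.norm_of_nonneg hα.le]
  have h1 : ‖ContinuousLinearMap.adjoint (P.gradg i t x) (dual P γ t i x)‖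
      ≤ G₂ * (γ₀ / α t * P.violation i t x) := by
    refine (ContinuousLinearMap.le_opNorm _ _).trans ?_
    rw [LinearIsometryEquiv.norm_map, dual, norm_smul, hγ, Real.norm_of_nonneg (by positivity)]
    exact mul_le_mul_of_nonneg_right (hP.gradg_le i t ht x hx)
      (mul_nonneg (by positivity) (norm_nonneg _))
  have h2 := (norm_add_le _ _).trans (add_le_add (hP.gradf_le i t ht x hx) h1)
  calc α t * ‖direction P γ t i x‖ ≤ α t * (G₁ + G₂ * (γ₀ / α t * P.violation i t x)) :=
        mul_le_mul_of_nonneg_left h2 hα.le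
    _ = _ := by field_simp

theorem norm_updateZ_sub_le (hP : P.Regular R G₁ G₂ L) (hγ₀ : 0 ≤ γ₀) {t : ℕ} (ht : 1 ≤ t)
    (hα : 0 < α t) (hγ : γ t = γ₀ / α t) (i : Fin n) {x : Vec p} (hx : x ∈ P.X) :
    ‖updateZ P α γ t i x - x‖ ≤ α t * G₁ + γ₀ * G₂ * P.violation i t x := by
  refine (norm_proj_sub_le hP.convex hP.closed _ hx).trans ?_
  rw [sub_sub_cancel_left, norm_neg]
  exact norm_smul_direction_le hP hγ₀ ht hα hγ i hx

/-- The descent inequality. The condition `4 G₂² γ₀ ≤ 1` lets the second-order term of the dual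
step be absorbed by a quarter of the first-order term `2 γ₀ ‖[g]₊‖²`. -/
theorem sq_norm_updateZ_sub_le (hP : P.Regular R G₁ G₂ L) (hγ₀ : 0 ≤ γ₀)
    (hγG : γ₀ * (4 * G₂ ^ 2) ≤ 1) {t : ℕ} (ht : 1 ≤ t) (hα : 0 < α t) (hγ : γ t = γ₀ / α t)
    (i : Fin n) {x y : Vec p} (hx : x ∈ P.X) (hy : y ∈ P.X) {ς : ℝ} (hς : 0 ≤ ς)
    (hgy : ∀ k, P.g i t y k ≤ -ς) :
    ‖updateZ P α γ t i x - y‖ ^ 2 + 2 * α t * inner ℝ (P.gradf i t x) (x - y)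
      + 3 / 2 * γ₀ * P.violation i t x ^ 2 + 2 * γ₀ * ς * P.violation i t x
      ≤ ‖x - y‖ ^ 2 + 2 * α t ^ 2 * G₁ ^ 2 := by
  set h := P.violation i t x with hh
  have h0 : 0 ≤ h := OnlineProblem.violation_nonneg i t x
  have h1 : ‖updateZ P α γ t i x - y‖ ^ 2 ≤ ‖(x - y) - α t • direction P γ t i x‖ ^ 2 := by
    rw [sub_right_comm]
    exact pow_le_pow_left₀ (norm_nonneg _) (norm_proj_sub_le hP.convex hP.closed _ hy) 2
  have h2 : α t * inner ℝ (direction P γ t i x) (x - y)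
      = α t * inner ℝ (P.gradf i t x) (x - y)
        + γ₀ * inner ℝ (orthantProj (P.g i t x)) (P.gradg i t x (x - y)) := by
    rw [direction, inner_add_left, ContinuousLinearMap.adjoint_inner_left, dual,
      real_inner_smul_left, hγ]
    field_simp
  have h3 := sq_norm_orthantProj_add_le_inner (v := P.g i t x) (u := P.g i t y)
    (d := P.gradg i t x (x - y)) hς (fun k => by
      have h4 := hP.subgrad_g i t ht x hx y hy k
      rw [← neg_sub x y, map_neg, PiLp.neg_apply] at h4
      linarith) hgy
  have h5 := norm_smul_direction_le hP hγ₀ ht hα hγ i hx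
  have h6 : ‖α t • direction P γ t i x‖ ^ 2 ≤ 2 * α t ^ 2 * G₁ ^ 2 + γ₀ / 2 * h ^ 2 := by
    refine (pow_le_pow_left₀ (norm_nonneg _) h5 2).trans ?_
    have h7 : γ₀ * h ^ 2 * (γ₀ * (4 * G₂ ^ 2)) ≤ γ₀ * h ^ 2 * 1 :=
      mul_le_mul_of_nonneg_left hγG (by positivity)
    nlinarith [sq_nonneg (α t * G₁ - γ₀ * G₂ * h)]
  rw [norm_sub_sq_real (x - y), real_inner_smul_right, real_inner_comm, h2] at h1
  have h8 := mul_le_mul_of_nonneg_left h3 hγ₀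
  change γ₀ * (h ^ 2 + ς * h) ≤ _ at h8
  linarith

end Algorithm

/-! ### Bounds along a single trajectory -/

/-- A trajectory of the algorithm in which the vectors `zh t i` are arbitrary points of the decision
set, regarded as inexact copies of the `z t i`. All that matters about the compressor is the size of
the errors `‖zh t i - z t i‖`. -/
structure IsTrajectory {n p : ℕ} {m : Fin n → ℕ} (P : OnlineProblem n p m) (N : Network n)
    (α γ : ℕ → ℝ) (z zh : ℕ → Fin n → Vec p) (x : Fin n → ℕ → Vec p) : Prop where
  z_mem : ∀ t, 1 ≤ t → ∀ i, z t i ∈ P.X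
  zh_mem : ∀ t, 1 ≤ t → ∀ i, zh t i ∈ P.X
  x_eq : ∀ t, 1 ≤ t → ∀ i, x i t = Algorithm.select N t (zh t) i
  z_succ : ∀ t, 1 ≤ t → ∀ i, z (t + 1) i = Algorithm.updateZ P α γ t i (x i t)

/-- The total compression error `∑ i, ‖zh i - z i‖` of one iteration. -/
noncomputable def totalError {n p : ℕ} (z zh : Fin n → Vec p) : ℝ := ∑ i, ‖zh i - z i‖

/-- Summation by parts against a nondecreasing weight sequence. -/
theorem sum_sub_mul_le {V c : ℕ → ℝ} {M : ℝ} (hV : ∀ t, 1 ≤ t → V t ≤ M)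
    (hV0 : ∀ t, 1 ≤ t → 0 ≤ V t) (hc0 : ∀ t, 1 ≤ t → 0 ≤ c t)
    (hc : ∀ t, 1 ≤ t → c t ≤ c (t + 1)) {T : ℕ} (hT : 1 ≤ T) :
    ∑ t ∈ Finset.Icc 1 T, (V t - V (t + 1)) * c t ≤ M * c T := by
  have key : ∑ t ∈ Finset.Icc 1 T, (V t - V (t + 1)) * c t ≤ (M - V (T + 1)) * c T := by
    induction T, hT using Nat.le_induction with
    | base =>
      rw [Finset.Icc_self, Finset.sum_singleton]
      exact mul_le_mul_of_nonneg_right (sub_le_sub_right (hV 1 le_rfl) _) (hc0 1 le_rfl)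
    | succ T hT ih =>
      rw [Finset.sum_Icc_succ_top (by lia)]
      have h1 := mul_le_mul_of_nonneg_left (hc T hT) (sub_nonneg.2 (hV (T + 1) (by lia)))
      linarith
  nlinarith [hV0 (T + 1) (by lia), hc0 T hT]

namespace IsTrajectory

variable {n p : ℕ} {m : Fin n → ℕ} {P : OnlineProblem n p m} {N : Network n} {R G₁ G₂ L γ₀ w : ℝ}
  {B : ℕ} {α γ : ℕ → ℝ} {z zh : ℕ → Fin n → Vec p} {x : Fin n → ℕ → Vec p}

theorem totalError_nonneg (z zh : Fin n → Vec p) : 0 ≤ totalError z zh :=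
  Finset.sum_nonneg fun _ _ => norm_nonneg _

theorem x_mem (hx : IsTrajectory P N α γ z zh x) (hP : P.Regular R G₁ G₂ L)
    (hN : N.Regular w B) (hw : 0 < w) {t : ℕ} (ht : 1 ≤ t) (i : Fin n) : x i t ∈ P.X := by
  rw [hx.x_eq t ht]
  exact hP.convex.sum_mem (fun j _ => hN.weight_nonneg hw ht i j) (hN.row_sum t ht i)
    fun j _ => hx.zh_mem t ht j

/-- By Jensen's inequality and double stochasticity, averaging does not increase the sum of the
squared distances to a point. -/
theorem sum_sq_norm_x_sub_le (hx : IsTrajectory P N α γ z zh x) (hP : P.Regular R G₁ G₂ L)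
    (hN : N.Regular w B) (hw : 0 < w) {t : ℕ} (ht : 1 ≤ t) {y : Vec p} (hy : y ∈ P.X) :
    ∑ i, ‖x i t - y‖ ^ 2 ≤ ∑ i, ‖z t i - y‖ ^ 2 + 4 * R * totalError (z t) (zh t) := by
  calc ∑ i, ‖x i t - y‖ ^ 2 ≤ ∑ i, ∑ j, N.W t i j * ‖zh t j - y‖ ^ 2 := by
        refine Finset.sum_le_sum fun i _ => ?_
        rw [hx.x_eq t ht]
        exact (pow_le_pow_left₀ (norm_nonneg _) (norm_average_sub_le
          (fun j => hN.weight_nonneg hw ht i j) (hN.row_sum t ht i) _ _) 2).trans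
          (Real.pow_arith_mean_le_arith_mean_pow _ _ _ (fun j _ => hN.weight_nonneg hw ht i j)
            (hN.row_sum t ht i) (fun j _ => norm_nonneg _) 2)
    _ = ∑ j, ‖zh t j - y‖ ^ 2 := by
        rw [Finset.sum_comm]
        exact Finset.sum_congr rfl fun j _ => by rw [← Finset.sum_mul, hN.col_sum t ht, one_mul]
    _ ≤ ∑ j, (‖z t j - y‖ ^ 2 + 4 * R * ‖zh t j - z t j‖) := by
        refine Finset.sum_le_sum fun j _ => ?_
        have h1 := norm_sub_le_norm_sub_add_norm_sub (zh t j) (z t j) y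
        have h2 := hP.norm_sub_le_two_mul (hx.zh_mem t ht j) hy
        have h3 := hP.norm_sub_le_two_mul (hx.z_mem t ht j) hy
        nlinarith [norm_nonneg (zh t j - y), norm_nonneg (z t j - y), norm_nonneg (zh t j - z t j)]
    _ = _ := by rw [Finset.sum_add_distrib, ← Finset.mul_sum, totalError]

/-- The descent inequality summed over the network. -/
theorem sum_descent (hx : IsTrajectory P N α γ z zh x) (hP : P.Regular R G₁ G₂ L)
    (hN : N.Regular w B) (hw : 0 < w) (hγ₀ : 0 ≤ γ₀) (hγG : γ₀ * (4 * G₂ ^ 2) ≤ 1) {t : ℕ}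
    (ht : 1 ≤ t) (hα : 0 < α t) (hγ : γ t = γ₀ / α t) {y : Vec p} (hy : y ∈ P.X) {ς : ℝ}
    (hς : 0 ≤ ς) (hgy : ∀ q, P.globalConstraint t y q ≤ -ς) :
    2 * α t * (∑ i, inner ℝ (P.gradf i t (x i t)) (x i t - y))
      + 3 / 2 * γ₀ * (∑ i, P.violation i t (x i t) ^ 2)
      + 2 * γ₀ * ς * (∑ i, P.violation i t (x i t))
      ≤ ∑ i, ‖z t i - y‖ ^ 2 - ∑ i, ‖z (t + 1) i - y‖ ^ 2 + 4 * R * totalError (z t) (zh t)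
        + 2 * n * α t ^ 2 * G₁ ^ 2 := by
  have h1 := hx.sum_sq_norm_x_sub_le hP hN hw ht hy
  have h2 := Finset.sum_le_sum fun i (_ : i ∈ Finset.univ) =>
    Algorithm.sq_norm_updateZ_sub_le hP hγ₀ hγG ht hα hγ i (hx.x_mem hP hN hw ht i) hy hς
      (fun k => hgy ⟨i, k⟩)
  simp only [Finset.sum_add_distrib, ← Finset.mul_sum, Finset.sum_const, Finset.card_univ,
    Fintype.card_fin, nsmul_eq_mul, ← hx.z_succ t ht] at h2
  linarith

/-- The consensus error: the diameters of the decisions sum up to a multiple of the sum of the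
step lengths and of the compression errors. -/
theorem sum_spread_x_le (hx : IsTrajectory P N α γ z zh x) (hP : P.Regular R G₁ G₂ L)
    (hN : N.Regular w B) (hw : 0 < w) (hγ₀ : 0 ≤ γ₀) (hα : ∀ t, 1 ≤ t → 0 < α t)
    (hγ : ∀ t, 1 ≤ t → γ t = γ₀ / α t) (hG₁ : 0 ≤ G₁) (hG₂ : 0 ≤ G₂) (T : ℕ) :
    ∑ t ∈ Finset.Icc 1 T, spread (fun i => x i t)
      ≤ (2 * ((n * B : ℕ) / w ^ (n * B)) + 2) * (R + ∑ t ∈ Finset.Icc 1 T,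
          (totalError (z t) (zh t) + α t * G₁
            + γ₀ * G₂ * ∑ i, P.violation i t (x i t))) := by
  set b : ℕ → ℝ := fun t => totalError (z t) (zh t) + α t * G₁
            + γ₀ * G₂ * ∑ i, P.violation i t (x i t) with hb
  have hR := hP.radius_nonneg
  have hviol : ∀ t, 0 ≤ ∑ i, P.violation i t (x i t) := fun t =>
    Finset.sum_nonneg fun i _ => OnlineProblem.violation_nonneg _ _ _
  have hEb : ∀ t, 1 ≤ t → totalError (z t) (zh t) ≤ b t := fun t ht => by
    have := mul_nonneg (mul_nonneg hγ₀ hG₂) (hviol t)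
    have := mul_nonneg (hα t ht).le hG₁
    simp only [hb]; linarith
  have hb0 : ∀ t, 1 ≤ t → 0 ≤ b t := fun t ht => (totalError_nonneg _ _).trans (hEb t ht)
  have he : ∀ t i, ‖zh t i - z t i‖ ≤ totalError (z t) (zh t) := fun t i =>
    Finset.single_le_sum (f := fun i => ‖zh t i - z t i‖) (fun _ _ => norm_nonneg _)
      (Finset.mem_univ i)
  have hu : ∀ t, 1 ≤ t → ∀ i, ‖z (t + 1) i - ∑ j, N.W t i j • z t j‖ ≤ b t := by
    intro t ht i
    have h1 : z (t + 1) i - ∑ j, N.W t i j • z t j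
        = ∑ j, N.W t i j • (zh t j - z t j) + (z (t + 1) i - x i t) := by
      rw [hx.x_eq t ht, Algorithm.select]
      simp only [smul_sub, Finset.sum_sub_distrib]
      abel
    have h2 : ‖∑ j, N.W t i j • (zh t j - z t j)‖ ≤ totalError (z t) (zh t) := by
      calc _ ≤ ∑ j, N.W t i j * totalError (z t) (zh t) := by
            refine (norm_sum_le _ _).trans (Finset.sum_le_sum fun j _ => ?_)
            rw [norm_smul, Real.norm_of_nonneg (hN.weight_nonneg hw ht i j)]
            exact mul_le_mul_of_nonneg_left (he t j) (hN.weight_nonneg hw ht i j)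
        _ = _ := by rw [← Finset.sum_mul, hN.row_sum t ht, one_mul]
    have h3 := Algorithm.norm_updateZ_sub_le hP hγ₀ ht (hα t ht) (hγ t ht) i
      (hx.x_mem hP hN hw ht i)
    rw [← hx.z_succ t ht] at h3
    have h4 := mul_le_mul_of_nonneg_left (Finset.single_le_sum
      (f := fun i => P.violation i t (x i t)) (fun i _ => OnlineProblem.violation_nonneg _ _ _)
      (Finset.mem_univ i)) (mul_nonneg hγ₀ hG₂)
    rw [h1]
    refine (norm_add_le _ _).trans ?_
    simp only [hb]
    linarith
  have hz := hN.sum_spread_le hw hu hb0 (D := 2 * R) (fun t ht =>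
    spread_le (by positivity) fun i j =>
      hP.norm_sub_le_two_mul (hx.z_mem t ht i) (hx.z_mem t ht j)) T
  have hxz : ∀ t, 1 ≤ t → spread (fun i => x i t) ≤ spread (z t) + 2 * b t := by
    intro t ht
    have h1 : (fun i => x i t) = fun i => ∑ j, N.W t i j • zh t j := by
      funext i; rw [hx.x_eq t ht, Algorithm.select]
    rw [h1]
    have h2 := spread_average_le (fun i j => hN.weight_nonneg hw ht i j) le_rfl (hN.row_sum t ht)
      (zh t)
    have h3 := spread_le_add (totalError_nonneg (z t) (zh t)) (he t)
    linarith [hEb t ht]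
  have hsum : ∑ t ∈ Finset.Icc 1 T, spread (fun i => x i t)
      ≤ ∑ t ∈ Finset.Icc 1 T, spread (z t) + 2 * ∑ t ∈ Finset.Icc 1 T, b t := by
    rw [Finset.mul_sum, ← Finset.sum_add_distrib]
    exact Finset.sum_le_sum fun t ht => hxz t (Finset.mem_Icc.1 ht).1
  have hwp : 0 < w ^ (n * B) := by positivity
  have hz' : ∑ t ∈ Finset.Icc 1 T, spread (z t)
      ≤ (n * B : ℕ) / w ^ (n * B) * (2 * R + 2 * ∑ t ∈ Finset.Icc 1 T, b t) := by
    rw [div_mul_eq_mul_div, le_div_iff₀ hwp, mul_comm]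
    exact hz
  linarith

/-- The sum of the squared violations, and of the violations themselves when the comparator `y`
has a margin `ς`, is controlled by the step sizes and the compression errors. -/
theorem sum_violation_le (hx : IsTrajectory P N α γ z zh x) (hP : P.Regular R G₁ G₂ L)
    (hN : N.Regular w B) (hw : 0 < w) (hγ₀ : 0 ≤ γ₀) (hγG : γ₀ * (4 * G₂ ^ 2) ≤ 1)
    (hα : ∀ t, 1 ≤ t → 0 < α t) {a : ℝ} (hαa : ∀ t, 1 ≤ t → α t ≤ a)
    (hγ : ∀ t, 1 ≤ t → γ t = γ₀ / α t) {T : ℕ} {y : Vec p} (hy : y ∈ P.X) {ς : ℝ}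
    (hς : 0 ≤ ς) (hgy : ∀ t ∈ Finset.Icc 1 T, ∀ q, P.globalConstraint t y q ≤ -ς) :
    3 / 2 * γ₀ * (∑ t ∈ Finset.Icc 1 T, ∑ i, P.violation i t (x i t) ^ 2)
      + 2 * γ₀ * ς * (∑ t ∈ Finset.Icc 1 T, ∑ i, P.violation i t (x i t))
      ≤ 4 * n * R ^ 2 + 4 * R * ∑ t ∈ Finset.Icc 1 T, totalError (z t) (zh t)
        + (2 * n * a * G₁ ^ 2 + 4 * n * R * G₁) * ∑ t ∈ Finset.Icc 1 T, α t := by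
  have hR := hP.radius_nonneg
  set V : ℕ → ℝ := fun t => ∑ i, ‖z t i - y‖ ^ 2 with hV
  have hV1 : ∀ t, 1 ≤ t → V t ≤ 4 * n * R ^ 2 := by
    intro t ht
    calc V t ≤ ∑ _i : Fin n, (2 * R) ^ 2 := Finset.sum_le_sum fun i _ =>
          pow_le_pow_left₀ (norm_nonneg _) (hP.norm_sub_le_two_mul (hx.z_mem t ht i) hy) 2
      _ = _ := by simp; ring
  have htel : ∑ t ∈ Finset.Icc 1 T, (V t - V (t + 1)) ≤ 4 * n * R ^ 2 := by
    rcases Nat.eq_zero_or_pos T with h | h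
    · subst h; simpa using by positivity
    · simpa using sum_sub_mul_le (c := fun _ => 1) hV1
        (fun t _ => Finset.sum_nonneg fun i _ => by positivity) (fun _ _ => zero_le_one)
        (fun _ _ => le_rfl) h
  have hstep : ∀ t ∈ Finset.Icc 1 T, 3 / 2 * γ₀ * (∑ i, P.violation i t (x i t) ^ 2)
      + 2 * γ₀ * ς * (∑ i, P.violation i t (x i t))
      ≤ (V t - V (t + 1)) + 4 * R * totalError (z t) (zh t)
        + (2 * n * a * G₁ ^ 2 + 4 * n * R * G₁) * α t := by
    intro t ht
    have ht1 := (Finset.mem_Icc.1 ht).1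
    have h1 := hx.sum_descent hP hN hw hγ₀ hγG ht1 (hα t ht1) (hγ t ht1) hy hς (hgy t ht)
    have h2 : -(n * (G₁ * (2 * R))) ≤ ∑ i, inner ℝ (P.gradf i t (x i t)) (x i t - y) := by
      have : ∑ _i : Fin n, -(G₁ * (2 * R)) ≤ ∑ i, inner ℝ (P.gradf i t (x i t)) (x i t - y) := by
        refine Finset.sum_le_sum fun i _ => ?_
        have hxm := hx.x_mem hP hN hw ht1 i
        refine (neg_le_neg ?_).trans (neg_abs_le _)
        exact (abs_real_inner_le_norm _ _).trans (mul_le_mul (hP.gradf_le i t ht1 _ hxm)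
          (hP.norm_sub_le_two_mul hxm hy) (norm_nonneg _) (hP.gradf_bound_nonneg i))
      simpa using this
    have h3 := mul_le_mul_of_nonneg_left h2 (mul_nonneg two_pos.le (hα t ht1).le)
    have h4 : α t ^ 2 * (2 * n * G₁ ^ 2) ≤ a * α t * (2 * n * G₁ ^ 2) := by
      rw [pow_two]
      exact mul_le_mul_of_nonneg_right (mul_le_mul_of_nonneg_right (hαa t ht1) (hα t ht1).le)
        (by positivity)
    simp only [hV]
    linarith
  have := Finset.sum_le_sum hstep
  simp only [Finset.sum_add_distrib, ← Finset.mul_sum] at this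
  linarith

/-- The regret of agent `i` against the fixed comparator `y`. -/
theorem sum_inner_globalGrad_le (hx : IsTrajectory P N α γ z zh x) (hP : P.Regular R G₁ G₂ L)
    (hN : N.Regular w B) (hw : 0 < w) (hγ₀ : 0 ≤ γ₀) (hγG : γ₀ * (4 * G₂ ^ 2) ≤ 1)
    (hα : ∀ t, 1 ≤ t → 0 < α t) (hanti : ∀ t, 1 ≤ t → α (t + 1) ≤ α t)
    (hγ : ∀ t, 1 ≤ t → γ t = γ₀ / α t) {T : ℕ} (hT : 1 ≤ T) {y : Vec p}
    (hy : y ∈ P.feasibleSet T) (i : Fin n) :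
    ∑ t ∈ Finset.Icc 1 T, inner ℝ (P.globalGrad t (x i t)) (x i t - y)
        + 1 / n * (3 / 4 * γ₀ * ∑ t ∈ Finset.Icc 1 T, (∑ j, P.violation j t (x j t) ^ 2) / α t)
      ≤ 1 / n * (2 * n * R ^ 2 / α T + 2 * R * ∑ t ∈ Finset.Icc 1 T, totalError (z t) (zh t) / α t
          + n * G₁ ^ 2 * ∑ t ∈ Finset.Icc 1 T, α t)
        + (2 * R * |L| + G₁) * ∑ t ∈ Finset.Icc 1 T, spread (fun i => x i t) := by
  have hR := hP.radius_nonneg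
  have hn : (0 : ℝ) < n := by exact_mod_cast i.pos
  set V : ℕ → ℝ := fun t => ∑ i, ‖z t i - y‖ ^ 2 with hV
  have hV1 : ∀ t, 1 ≤ t → V t ≤ 4 * n * R ^ 2 := by
    intro t ht
    calc V t ≤ ∑ _i : Fin n, (2 * R) ^ 2 := Finset.sum_le_sum fun i _ =>
          pow_le_pow_left₀ (norm_nonneg _) (hP.norm_sub_le_two_mul (hx.z_mem t ht i) hy.1) 2
      _ = _ := by simp; ring
  have htel : ∑ t ∈ Finset.Icc 1 T, (V t - V (t + 1)) * (1 / (2 * α t))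
      ≤ 4 * n * R ^ 2 * (1 / (2 * α T)) := by
    refine sum_sub_mul_le hV1 (fun t _ => Finset.sum_nonneg fun i _ => by positivity)
      (fun t ht => ?_) (fun t ht => ?_) hT
    · have := hα t ht
      positivity
    · have h1 := hα (t + 1) (by lia)
      have h2 := hanti t ht
      gcongr
  have hlocal : ∀ t ∈ Finset.Icc 1 T, inner ℝ (P.globalGrad t (x i t)) (x i t - y)
      ≤ 1 / n * (∑ j, inner ℝ (P.gradf j t (x j t)) (x j t - y))
        + (2 * R * |L| + G₁) * spread (fun i => x i t) := by
    intro t ht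
    have ht1 := (Finset.mem_Icc.1 ht).1
    have hxi := hx.x_mem hP hN hw ht1 i
    have h1 : ∀ j, inner ℝ (P.gradf j t (x i t)) (x i t - y)
        ≤ inner ℝ (P.gradf j t (x j t)) (x j t - y)
          + (2 * R * |L| + G₁) * spread (fun i => x i t) := by
      intro j
      have hxj := hx.x_mem hP hN hw ht1 j
      have hs : ‖x i t - x j t‖ ≤ spread (fun i => x i t) :=
        norm_sub_le_spread (fun i => x i t) i j
      have e1 : inner ℝ (P.gradf j t (x i t)) (x i t - y)
          = inner ℝ (P.gradf j t (x j t)) (x j t - y)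
            + inner ℝ (P.gradf j t (x i t) - P.gradf j t (x j t)) (x i t - y)
            + inner ℝ (P.gradf j t (x j t)) (x i t - x j t) := by
        simp only [inner_sub_left, inner_sub_right]; ring
      have e2 : inner ℝ (P.gradf j t (x i t) - P.gradf j t (x j t)) (x i t - y)
          ≤ |L| * spread (fun i => x i t) * (2 * R) := by
        refine (real_inner_le_norm _ _).trans (mul_le_mul ?_ (hP.norm_sub_le_two_mul hxi hy.1)
          (norm_nonneg _) (mul_nonneg (abs_nonneg _) (spread_nonneg _)))
        exact (hP.gradf_lipschitz j t ht1 _ hxi _ hxj).trans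
          (mul_le_mul (le_abs_self L) hs (norm_nonneg _) (abs_nonneg _))
      have e3 : inner ℝ (P.gradf j t (x j t)) (x i t - x j t)
          ≤ G₁ * spread (fun i => x i t) :=
        (real_inner_le_norm _ _).trans (mul_le_mul (hP.gradf_le j t ht1 _ hxj) hs
          (norm_nonneg _) (hP.gradf_bound_nonneg j))
      linarith
    calc inner ℝ (P.globalGrad t (x i t)) (x i t - y)
        = 1 / n * ∑ j, inner ℝ (P.gradf j t (x i t)) (x i t - y) := by
          rw [OnlineProblem.globalGrad, real_inner_smul_left, sum_inner]
      _ ≤ 1 / n * ∑ j, (inner ℝ (P.gradf j t (x j t)) (x j t - y)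
          + (2 * R * |L| + G₁) * spread (fun i => x i t)) := by
          gcongr with j _
          exact h1 j
      _ = _ := by
          rw [Finset.sum_add_distrib, Finset.sum_const, Finset.card_univ, Fintype.card_fin,
            nsmul_eq_mul]
          field_simp
  have hdesc : ∀ t ∈ Finset.Icc 1 T, ∑ j, inner ℝ (P.gradf j t (x j t)) (x j t - y)
      + 3 / 4 * γ₀ * ((∑ j, P.violation j t (x j t) ^ 2) / α t)
      ≤ (V t - V (t + 1)) * (1 / (2 * α t)) + 2 * R * (totalError (z t) (zh t) / α t)
        + n * G₁ ^ 2 * α t := by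
    intro t ht
    have ht1 := (Finset.mem_Icc.1 ht).1
    have hαt := hα t ht1
    have h1 := hx.sum_descent hP hN hw hγ₀ hγG ht1 hαt (hγ t ht1) hy.1 le_rfl
      (fun q => by simpa using hy.2 t ht q)
    have h2 := mul_le_mul_of_nonneg_right h1 (show 0 ≤ 1 / (2 * α t) by positivity)
    refine (le_of_eq ?_).trans (h2.trans (le_of_eq ?_))
    · field_simp; ring
    · simp only [hV]; field_simp; ring
  have hs1 := Finset.sum_le_sum hlocal
  have hs2 := mul_le_mul_of_nonneg_left (Finset.sum_le_sum hdesc) (show 0 ≤ 1 / (n : ℝ) by positivity)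
  have hs3 := mul_le_mul_of_nonneg_left htel (show 0 ≤ 1 / (n : ℝ) by positivity)
  have e : 4 * n * R ^ 2 * (1 / (2 * α T)) = 2 * n * R ^ 2 / α T := by field_simp; ring
  rw [e] at hs3
  simp only [Finset.sum_add_distrib, ← Finset.mul_sum] at hs1 hs2
  linarith

end IsTrajectory

/-- The average regret is bounded by the step sizes and the compression errors, with a constant that
depends only on the parameters. The consensus errors contribute a multiple of the violations, which
the negative term `-‖[g]₊‖² / α` of the descent inequality absorbs up to a multiple of `α`. -/
theorem exists_netReg_le {n p : ℕ} (hn : 0 < n) (R G₁ G₂ L : ℝ) {w : ℝ} (hw : 0 < w) (B : ℕ)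
    {γ₀ : ℝ} (hγ₀ : 0 < γ₀) (hγG : γ₀ * (4 * G₂ ^ 2) ≤ 1) {a : ℝ} (ha : 0 ≤ a) :
    ∃ K : ℝ, 0 ≤ K ∧ ∀ (m : Fin n → ℕ) (P : OnlineProblem n p m) (N : Network n) (α γ : ℕ → ℝ)
      (z zh : ℕ → Fin n → Vec p) (x : Fin n → ℕ → Vec p), P.Regular R G₁ G₂ L → N.Regular w B →
      IsTrajectory P N α γ z zh x → (∀ t, 1 ≤ t → 0 < α t) → (∀ t, 1 ≤ t → α (t + 1) ≤ α t) →
      (∀ t, 1 ≤ t → α t ≤ a) → (∀ t, 1 ≤ t → γ t = γ₀ / α t) → ∀ T, 1 ≤ T →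
      P.netReg x T ≤ K * (1 + 1 / α T + ∑ t ∈ Finset.Icc 1 T, α t
        + ∑ t ∈ Finset.Icc 1 T, totalError (z t) (zh t) / α t) := by
  have hn0 : (0 : ℝ) < n := by exact_mod_cast hn
  by_cases hpos : 0 ≤ R ∧ 0 ≤ G₁ ∧ 0 ≤ G₂
  swap
  · exact ⟨0, le_rfl, fun m P N α γ z zh x hP => absurd
      ⟨hP.radius_nonneg, hP.gradf_bound_nonneg ⟨0, hn⟩, hP.gradg_bound_nonneg ⟨0, hn⟩⟩ hpos⟩
  obtain ⟨hR, hG₁, hG₂⟩ := hpos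
  set Λ : ℝ := 2 * ((n * B : ℕ) / w ^ (n * B)) + 2 with hΛ
  have hΛ0 : 0 ≤ Λ := by positivity
  set κ : ℝ := (2 * R * |L| + G₁) * Λ with hκ
  have hκ0 : 0 ≤ κ := by positivity
  set q : ℝ := κ * (γ₀ * G₂) with hq
  set c₁ : ℝ := 2 * R ^ 2
  set c₂ : ℝ := 1 / n * (2 * R) + κ * a
  set c₃ : ℝ := G₁ ^ 2 + κ * G₁ + q ^ 2 * n ^ 2 / (3 * γ₀)
  set c₄ : ℝ := κ * R
  have hc₁ : 0 ≤ c₁ := by positivity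
  have hc₂ : 0 ≤ c₂ := by positivity
  have hc₃ : 0 ≤ c₃ := by positivity
  have hc₄ : 0 ≤ c₄ := by positivity
  refine ⟨c₁ + c₂ + c₃ + c₄, by positivity, ?_⟩
  intro m P N α γ z zh x hP hN hx hα hanti hαa hγ T hT
  set U := ∑ t ∈ Finset.Icc 1 T, totalError (z t) (zh t) / α t with hU
  set A := ∑ t ∈ Finset.Icc 1 T, α t with hA
  set Qs := ∑ t ∈ Finset.Icc 1 T, (∑ j, P.violation j t (x j t) ^ 2) / α t with hQs
  set H := ∑ t ∈ Finset.Icc 1 T, ∑ j, P.violation j t (x j t) with hH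
  have hαT := hα T hT
  have hU0 : 0 ≤ U := Finset.sum_nonneg fun t ht =>
    div_nonneg (IsTrajectory.totalError_nonneg _ _) (hα t (Finset.mem_Icc.1 ht).1).le
  have hA0 : 0 ≤ A := Finset.sum_nonneg fun t ht => (hα t (Finset.mem_Icc.1 ht).1).le
  have hEU : ∑ t ∈ Finset.Icc 1 T, totalError (z t) (zh t) ≤ a * U := by
    rw [hU, Finset.mul_sum]
    refine Finset.sum_le_sum fun t ht => ?_
    have ht1 := (Finset.mem_Icc.1 ht).1
    have h0 := hα t ht1
    rw [mul_div_assoc', le_div_iff₀ h0, mul_comm]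
    exact mul_le_mul_of_nonneg_right (hαa t ht1) (IsTrajectory.totalError_nonneg _ _)
  have hsp := hx.sum_spread_x_le hP hN hw hγ₀.le hα hγ hG₁ hG₂ T
  simp only [Finset.sum_add_distrib, ← Finset.mul_sum, ← Finset.sum_mul] at hsp
  have hqH : q * H ≤ 1 / n * (3 / 4 * γ₀ * Qs) + q ^ 2 * n ^ 2 / (3 * γ₀) * A := by
    simp only [hH, hQs, hA, Finset.mul_sum, ← Finset.sum_add_distrib]
    refine Finset.sum_le_sum fun t ht => ?_
    have h0 := hα t (Finset.mem_Icc.1 ht).1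
    have hterm : ∀ j, q * P.violation j t (x j t)
        ≤ 1 / n * (3 / 4 * γ₀ * (P.violation j t (x j t) ^ 2 / α t))
          + q ^ 2 * n / (3 * γ₀) * α t := by
      intro j
      generalize P.violation j t (x j t) = h
      have : 1 / n * (3 / 4 * γ₀ * (h ^ 2 / α t)) + q ^ 2 * n / (3 * γ₀) * α t - q * h
          = (3 * γ₀ * h - 2 * n * q * α t) ^ 2 / (12 * n * γ₀ * α t) := by
        field_simp; ring
      have : 0 ≤ (3 * γ₀ * h - 2 * n * q * α t) ^ 2 / (12 * n * γ₀ * α t) := by positivity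
      linarith
    have hs := Finset.sum_le_sum fun j (_ : j ∈ Finset.univ) => hterm j
    simp only [Finset.sum_add_distrib, ← Finset.mul_sum, ← Finset.sum_div, Finset.sum_const,
      Finset.card_univ, Fintype.card_fin, nsmul_eq_mul] at hs
    refine (le_of_eq ?_).trans (hs.trans (le_of_eq ?_))
    · rw [Finset.mul_sum]
    · ring
  have hagent : ∀ i, ∑ t ∈ Finset.Icc 1 T, inner ℝ (P.globalGrad t (x i t)) (x i t)
      - sInf ((fun y => inner ℝ (∑ t ∈ Finset.Icc 1 T, P.globalGrad t (x i t)) y)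
        '' P.feasibleSet T) ≤ c₁ * (1 / α T) + c₂ * U + c₃ * A + c₄ := by
    intro i
    rw [sub_le_comm]
    refine le_csInf ((hP.feasible T hT).image _) ?_
    rintro _ ⟨y, hy, rfl⟩
    have h1 := hx.sum_inner_globalGrad_le hP hN hw hγ₀.le hγG hα hanti hγ hT hy i
    simp only [inner_sub_right, Finset.sum_sub_distrib] at h1
    simp only [sum_inner]
    have h2 := mul_le_mul_of_nonneg_left hsp (show 0 ≤ 2 * R * |L| + G₁ by positivity)
    have h3 := mul_le_mul_of_nonneg_left hEU hκ0
    have h4 : 1 / (n : ℝ) * (2 * n * R ^ 2 / α T + 2 * R * U + n * G₁ ^ 2 * A)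
        = c₁ * (1 / α T) + 1 / n * (2 * R) * U + G₁ ^ 2 * A := by
      simp only [c₁]; field_simp
    have h5 : (2 * R * |L| + G₁) * (Λ * (R + (∑ t ∈ Finset.Icc 1 T, totalError (z t) (zh t)
        + A * G₁ + γ₀ * G₂ * H))) = c₄ + κ * ∑ t ∈ Finset.Icc 1 T, totalError (z t) (zh t)
        + κ * G₁ * A + q * H := by
      simp only [c₄, hκ, hq]; ring
    have h6 : c₂ * U + c₃ * A = 1 / n * (2 * R) * U + κ * (a * U) + G₁ ^ 2 * A + κ * G₁ * A
        + q ^ 2 * n ^ 2 / (3 * γ₀) * A := by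
      simp only [c₂, c₃]; ring
    linarith
  have hav : P.netReg x T ≤ c₁ * (1 / α T) + c₂ * U + c₃ * A + c₄ := by
    rw [OnlineProblem.netReg, one_div_mul_eq_div, div_le_iff₀ hn0]
    refine (Finset.sum_le_sum fun i _ => hagent i).trans (le_of_eq ?_)
    rw [Finset.sum_const, Finset.card_univ, Fintype.card_fin, nsmul_eq_mul, mul_comm]
  have hi : 0 ≤ 1 / α T := by positivity
  refine hav.trans ?_
  generalize 1 / α T = I at *
  have p1 := mul_nonneg hc₁ hU0
  have p2 := mul_nonneg hc₁ hA0
  have p3 := mul_nonneg hc₂ hi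
  have p4 := mul_nonneg hc₂ hA0
  have p5 := mul_nonneg hc₃ hi
  have p6 := mul_nonneg hc₃ hU0
  have p7 := mul_nonneg hc₄ hi
  have p8 := mul_nonneg hc₄ hU0
  have p9 := mul_nonneg hc₄ hA0
  linarith

/-- The average violation of the global constraints exceeds the local violations by the consensus
error only. -/
theorem exists_netCCV_le {n p : ℕ} (hn : 0 < n) (R G₁ G₂ L : ℝ) {w : ℝ} (hw : 0 < w) (B : ℕ)
    {γ₀ : ℝ} (hγ₀ : 0 < γ₀) :
    ∃ K : ℝ, 0 ≤ K ∧ ∀ (m : Fin n → ℕ) (P : OnlineProblem n p m) (N : Network n) (α γ : ℕ → ℝ)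
      (z zh : ℕ → Fin n → Vec p) (x : Fin n → ℕ → Vec p), P.Regular R G₁ G₂ L → N.Regular w B →
      IsTrajectory P N α γ z zh x → (∀ t, 1 ≤ t → 0 < α t) →
      (∀ t, 1 ≤ t → γ t = γ₀ / α t) → ∀ T,
      P.netCCV x T ≤ K * (1 + ∑ t ∈ Finset.Icc 1 T, α t
        + ∑ t ∈ Finset.Icc 1 T, totalError (z t) (zh t)
        + ∑ t ∈ Finset.Icc 1 T, ∑ i, P.violation i t (x i t)) := by
  have hn0 : (0 : ℝ) < n := by exact_mod_cast hn
  by_cases hpos : 0 ≤ R ∧ 0 ≤ G₁ ∧ 0 ≤ G₂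
  swap
  · exact ⟨0, le_rfl, fun m P N α γ z zh x hP => absurd
      ⟨hP.radius_nonneg, hP.gradf_bound_nonneg ⟨0, hn⟩, hP.gradg_bound_nonneg ⟨0, hn⟩⟩ hpos⟩
  obtain ⟨hR, hG₁, hG₂⟩ := hpos
  set Λ : ℝ := n * G₂ * (2 * ((n * B : ℕ) / w ^ (n * B)) + 2) with hΛ
  have hΛ0 : 0 ≤ Λ := by positivity
  refine ⟨1 + Λ * (R + 1 + G₁ + γ₀ * G₂), by positivity, ?_⟩
  intro m P N α γ z zh x hP hN hx hα hγ T
  set A := ∑ t ∈ Finset.Icc 1 T, α t with hA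
  set U := ∑ t ∈ Finset.Icc 1 T, totalError (z t) (zh t) with hU
  set H := ∑ t ∈ Finset.Icc 1 T, ∑ j, P.violation j t (x j t) with hH
  have hA0 : 0 ≤ A := Finset.sum_nonneg fun t ht => (hα t (Finset.mem_Icc.1 ht).1).le
  have hU0 : 0 ≤ U := Finset.sum_nonneg fun t _ => IsTrajectory.totalError_nonneg _ _
  have hH0 : 0 ≤ H := Finset.sum_nonneg fun t _ => Finset.sum_nonneg fun i _ =>
    OnlineProblem.violation_nonneg _ _ _
  have hsp := hx.sum_spread_x_le hP hN hw hγ₀.le hα hγ hG₁ hG₂ T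
  simp only [Finset.sum_add_distrib, ← Finset.mul_sum, ← Finset.sum_mul] at hsp
  have hagent : ∀ i, ∑ t ∈ Finset.Icc 1 T, ‖orthantProj (P.globalConstraint t (x i t))‖
      ≤ H + n * G₂ * ∑ t ∈ Finset.Icc 1 T, spread (fun i => x i t) := by
    intro i
    rw [hH, Finset.mul_sum, ← Finset.sum_add_distrib]
    refine Finset.sum_le_sum fun t ht => ?_
    have ht1 := (Finset.mem_Icc.1 ht).1
    refine (OnlineProblem.norm_orthantProj_globalConstraint_le t _).trans ?_
    calc ∑ j, P.violation j t (x i t)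
        ≤ ∑ j, (P.violation j t (x j t) + G₂ * spread (fun i => x i t)) :=
          Finset.sum_le_sum fun j _ => (hP.violation_le ht1 (hx.x_mem hP hN hw ht1 i)
            (hx.x_mem hP hN hw ht1 j)).trans (add_le_add_right
              (mul_le_mul_of_nonneg_left (norm_sub_le_spread (fun i => x i t) i j) hG₂) _)
      _ = _ := by
          rw [Finset.sum_add_distrib, Finset.sum_const, Finset.card_univ, Fintype.card_fin,
            nsmul_eq_mul, mul_assoc]
  have hav : P.netCCV x T ≤ H + n * G₂ * ∑ t ∈ Finset.Icc 1 T, spread (fun i => x i t) := by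
    rw [OnlineProblem.netCCV, one_div_mul_eq_div, div_le_iff₀ hn0]
    refine (Finset.sum_le_sum fun i _ => hagent i).trans (le_of_eq ?_)
    rw [Finset.sum_const, Finset.card_univ, Fintype.card_fin, nsmul_eq_mul, mul_comm]
  have h2 := mul_le_mul_of_nonneg_left hsp (show 0 ≤ n * G₂ by positivity)
  have h3 : n * G₂ * ((2 * ((n * B : ℕ) / w ^ (n * B)) + 2) * (R + (U + A * G₁ + γ₀ * G₂ * H)))
      = Λ * (R + (U + A * G₁ + γ₀ * G₂ * H)) := by
    rw [hΛ]; ring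
  have h4 : R + (U + A * G₁ + γ₀ * G₂ * H) ≤ (R + 1 + G₁ + γ₀ * G₂) * (1 + A + U + H) := by
    have : 0 ≤ γ₀ * G₂ := by positivity
    have p1 := mul_nonneg hR hA0
    have p2 := mul_nonneg hR hU0
    have p3 := mul_nonneg hR hH0
    have p4 := mul_nonneg hG₁ hU0
    have p5 := mul_nonneg hG₁ hH0
    have p6 := mul_nonneg this hA0
    have p7 := mul_nonneg this hU0
    linarith
  have h5 := mul_le_mul_of_nonneg_left h4 hΛ0
  linarith

/-- The sum of the local violations, and of their squares, against the step sizes and the errors. -/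
theorem exists_sum_violation_le {n p : ℕ} (R G₁ G₂ L : ℝ) {w : ℝ} (hw : 0 < w) (B : ℕ)
    {γ₀ : ℝ} (hγ₀ : 0 < γ₀) (hγG : γ₀ * (4 * G₂ ^ 2) ≤ 1) (a : ℝ) :
    ∃ K : ℝ, 0 ≤ K ∧ ∀ (m : Fin n → ℕ) (P : OnlineProblem n p m) (N : Network n) (α γ : ℕ → ℝ)
      (z zh : ℕ → Fin n → Vec p) (x : Fin n → ℕ → Vec p), P.Regular R G₁ G₂ L → N.Regular w B →
      IsTrajectory P N α γ z zh x → (∀ t, 1 ≤ t → 0 < α t) → (∀ t, 1 ≤ t → α t ≤ a) →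
      (∀ t, 1 ≤ t → γ t = γ₀ / α t) → ∀ T, ∀ y ∈ P.X, ∀ ς : ℝ, 0 ≤ ς →
      (∀ t ∈ Finset.Icc 1 T, ∀ q, P.globalConstraint t y q ≤ -ς) →
      ∑ t ∈ Finset.Icc 1 T, ∑ i, P.violation i t (x i t) ^ 2
        + ς * ∑ t ∈ Finset.Icc 1 T, ∑ i, P.violation i t (x i t)
        ≤ K * (1 + ∑ t ∈ Finset.Icc 1 T, α t
          + ∑ t ∈ Finset.Icc 1 T, totalError (z t) (zh t)) := by
  set c₁ : ℝ := 4 * n * R ^ 2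
  set c₂ : ℝ := 4 * |R|
  set c₃ : ℝ := |2 * n * a * G₁ ^ 2 + 4 * n * R * G₁|
  have hc₁ : 0 ≤ c₁ := by positivity
  have hc₂ : 0 ≤ c₂ := by positivity
  have hc₃ : 0 ≤ c₃ := by positivity
  refine ⟨(c₁ + c₂ + c₃) / γ₀, by positivity, ?_⟩
  intro m P N α γ z zh x hP hN hx hα hαa hγ T y hy ς hς hgy
  have h := hx.sum_violation_le hP hN hw hγ₀.le hγG hα hαa hγ hy hς hgy
  set A := ∑ t ∈ Finset.Icc 1 T, α t with hA
  set U := ∑ t ∈ Finset.Icc 1 T, totalError (z t) (zh t) with hU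
  set H := ∑ t ∈ Finset.Icc 1 T, ∑ j, P.violation j t (x j t) with hH
  set S := ∑ t ∈ Finset.Icc 1 T, ∑ j, P.violation j t (x j t) ^ 2 with hS
  have hA0 : 0 ≤ A := Finset.sum_nonneg fun t ht => (hα t (Finset.mem_Icc.1 ht).1).le
  have hU0 : 0 ≤ U := Finset.sum_nonneg fun t _ => IsTrajectory.totalError_nonneg _ _
  have hH0 : 0 ≤ H := Finset.sum_nonneg fun t _ => Finset.sum_nonneg fun i _ =>
    OnlineProblem.violation_nonneg _ _ _
  have hS0 : 0 ≤ S := Finset.sum_nonneg fun t _ => Finset.sum_nonneg fun i _ => sq_nonneg _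
  rw [div_mul_eq_mul_div, le_div_iff₀ hγ₀]
  have h1 : 4 * R * U ≤ c₂ * U :=
    mul_le_mul_of_nonneg_right (mul_le_mul_of_nonneg_left (le_abs_self R) (by norm_num)) hU0
  have h2 := mul_le_mul_of_nonneg_right (le_abs_self (2 * n * a * G₁ ^ 2 + 4 * n * R * G₁)) hA0
  change _ ≤ c₃ * A at h2
  have q1 : 0 ≤ γ₀ * S := by positivity
  have q2 : 0 ≤ γ₀ * ς * H := by positivity
  have p1 := mul_nonneg hc₁ hA0
  have p2 := mul_nonneg hc₁ hU0
  have p3 := mul_nonneg hc₂ hA0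
  have p4 := mul_nonneg hc₃ hU0
  change _ ≤ c₁ + _ + _ at h
  linarith

/-- Without Slater's condition only the squared violations are controlled. The inequality
`h ≤ τ h ^ 2 + τ⁻¹` passes to the violations, with a free parameter `τ`. -/
theorem exists_netCCV_le_of_feasible {n p : ℕ} (hn : 0 < n) (R G₁ G₂ L : ℝ) {w : ℝ} (hw : 0 < w)
    (B : ℕ) {γ₀ : ℝ} (hγ₀ : 0 < γ₀) (hγG : γ₀ * (4 * G₂ ^ 2) ≤ 1) (a : ℝ) :
    ∃ K : ℝ, 0 ≤ K ∧ ∀ (m : Fin n → ℕ) (P : OnlineProblem n p m) (N : Network n) (α γ : ℕ → ℝ)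
      (z zh : ℕ → Fin n → Vec p) (x : Fin n → ℕ → Vec p), P.Regular R G₁ G₂ L → N.Regular w B →
      IsTrajectory P N α γ z zh x → (∀ t, 1 ≤ t → 0 < α t) → (∀ t, 1 ≤ t → α t ≤ a) →
      (∀ t, 1 ≤ t → γ t = γ₀ / α t) → ∀ T, 1 ≤ T → ∀ τ : ℝ, 1 ≤ τ →
      P.netCCV x T ≤ K * (T / τ + τ * (1 + ∑ t ∈ Finset.Icc 1 T, α t
        + ∑ t ∈ Finset.Icc 1 T, totalError (z t) (zh t))) := by
  obtain ⟨K₁, hK₁, h₁⟩ := exists_netCCV_le (p := p) hn R G₁ G₂ L hw B hγ₀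
  obtain ⟨K₂, hK₂, h₂⟩ := exists_sum_violation_le (n := n) (p := p) R G₁ G₂ L hw B hγ₀ hγG a
  refine ⟨K₁ * (1 + n + K₂), by positivity, ?_⟩
  intro m P N α γ z zh x hP hN hx hα hαa hγ T hT τ hτ
  have e₁ := h₁ m P N α γ z zh x hP hN hx hα hγ T
  obtain ⟨y, hy⟩ := hP.feasible T hT
  have e₂ := h₂ m P N α γ z zh x hP hN hx hα hαa hγ T y hy.1 0 le_rfl
    (fun t ht q => by simpa using hy.2 t ht q)
  rw [zero_mul, add_zero] at e₂
  have hτ0 : 0 < τ := by linarith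
  have hHS : ∑ t ∈ Finset.Icc 1 T, ∑ j, P.violation j t (x j t)
      ≤ τ * ∑ t ∈ Finset.Icc 1 T, ∑ j, P.violation j t (x j t) ^ 2 + n * (T / τ) := by
    have hpt : ∀ h : ℝ, h ≤ τ * h ^ 2 + 1 / τ := by
      intro h
      have h3 : τ * h ^ 2 + 1 / τ - h = ((2 * τ * h - 1) ^ 2 + 3) / (4 * τ) := by
        field_simp; ring
      have h4 : 0 ≤ ((2 * τ * h - 1) ^ 2 + 3) / (4 * τ) := by positivity
      linarith
    calc _ ≤ ∑ t ∈ Finset.Icc 1 T, ∑ j, (τ * P.violation j t (x j t) ^ 2 + 1 / τ) :=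
          Finset.sum_le_sum fun t _ => Finset.sum_le_sum fun j _ => hpt _
      _ = _ := by
          simp only [Finset.sum_add_distrib, ← Finset.mul_sum, Finset.sum_const, Finset.card_univ,
            Fintype.card_fin, Nat.card_Icc, nsmul_eq_mul, Nat.add_sub_cancel]
          ring
  set Z := 1 + ∑ t ∈ Finset.Icc 1 T, α t + ∑ t ∈ Finset.Icc 1 T, totalError (z t) (zh t) with hZ
  have hZ0 : 0 ≤ Z := add_nonneg (add_nonneg zero_le_one
    (Finset.sum_nonneg fun t ht => (hα t (Finset.mem_Icc.1 ht).1).le))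
    (Finset.sum_nonneg fun t _ => IsTrajectory.totalError_nonneg _ _)
  have h5 := mul_le_mul_of_nonneg_left e₂ hτ0.le
  have h6 : Z ≤ τ * Z := le_mul_of_one_le_left hZ0 hτ
  have hTτ : 0 ≤ (T : ℝ) / τ := by positivity
  refine e₁.trans ?_
  rw [mul_assoc]
  refine mul_le_mul_of_nonneg_left ?_ hK₁
  have p1 := mul_nonneg hK₂ hTτ
  have p2 : 0 ≤ n * (τ * Z) := by positivity
  linarith

theorem exists_netCCV_le_of_slater {n p : ℕ} (hn : 0 < n) (R G₁ G₂ L : ℝ) {w : ℝ} (hw : 0 < w)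
    (B : ℕ) {γ₀ : ℝ} (hγ₀ : 0 < γ₀) (hγG : γ₀ * (4 * G₂ ^ 2) ≤ 1) (a : ℝ) {ς : ℝ} (hς : 0 < ς) :
    ∃ K : ℝ, 0 ≤ K ∧ ∀ (m : Fin n → ℕ) (P : OnlineProblem n p m) (N : Network n) (α γ : ℕ → ℝ)
      (z zh : ℕ → Fin n → Vec p) (x : Fin n → ℕ → Vec p), P.Regular R G₁ G₂ L → N.Regular w B →
      IsTrajectory P N α γ z zh x → (∀ t, 1 ≤ t → 0 < α t) → (∀ t, 1 ≤ t → α t ≤ a) →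
      (∀ t, 1 ≤ t → γ t = γ₀ / α t) → P.Slater ς → ∀ T,
      P.netCCV x T ≤ K * (1 + ∑ t ∈ Finset.Icc 1 T, α t
        + ∑ t ∈ Finset.Icc 1 T, totalError (z t) (zh t)) := by
  obtain ⟨K₁, hK₁, h₁⟩ := exists_netCCV_le (p := p) hn R G₁ G₂ L hw B hγ₀
  obtain ⟨K₂, hK₂, h₂⟩ := exists_sum_violation_le (n := n) (p := p) R G₁ G₂ L hw B hγ₀ hγG a
  refine ⟨K₁ * (1 + K₂ / ς), by positivity, ?_⟩
  intro m P N α γ z zh x hP hN hx hα hαa hγ ⟨y, hy, hgy⟩ T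
  have e₁ := h₁ m P N α γ z zh x hP hN hx hα hγ T
  have e₂ := h₂ m P N α γ z zh x hP hN hx hα hαa hγ T y hy ς hς.le
    (fun t ht q => hgy t (Finset.mem_Icc.1 ht).1 q)
  have hS0 : 0 ≤ ∑ t ∈ Finset.Icc 1 T, ∑ j, P.violation j t (x j t) ^ 2 :=
    Finset.sum_nonneg fun t _ => Finset.sum_nonneg fun i _ => sq_nonneg _
  set Z := 1 + ∑ t ∈ Finset.Icc 1 T, α t + ∑ t ∈ Finset.Icc 1 T, totalError (z t) (zh t) with hZ
  have h3 : ∑ t ∈ Finset.Icc 1 T, ∑ j, P.violation j t (x j t) ≤ K₂ / ς * Z := by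
    rw [div_mul_eq_mul_div, le_div_iff₀ hς, mul_comm]
    linarith
  refine e₁.trans ?_
  rw [mul_assoc]
  refine mul_le_mul_of_nonneg_left ?_ hK₁
  linarith

/-! ### Measurability of the iterates -/

theorem continuous_orthantProj {ι : Type*} :
    Continuous (orthantProj : EuclideanSpace ℝ ι → EuclideanSpace ℝ ι) := by
  unfold orthantProj
  fun_prop

namespace OnlineProblem.Regular

variable {n p : ℕ} {m : Fin n → ℕ} {P : OnlineProblem n p m} {R G₁ G₂ L : ℝ}

theorem continuous_gradf (hP : P.Regular R G₁ G₂ L) (i : Fin n) {t : ℕ} (ht : 1 ≤ t) :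
    Continuous fun x : P.X => P.gradf i t x :=
  (LipschitzWith.of_dist_le_mul (K := Real.toNNReal |L|) fun x y => by
    rw [dist_eq_norm, Subtype.dist_eq, dist_eq_norm, Real.coe_toNNReal _ (abs_nonneg L)]
    exact (hP.gradf_lipschitz i t ht x x.2 y y.2).trans
      (mul_le_mul_of_nonneg_right (le_abs_self L) (norm_nonneg _))).continuous

/-- Each component of `g` is Lipschitz on the decision set, since its subgradients are bounded. -/
theorem continuous_g (hP : P.Regular R G₁ G₂ L) (i : Fin n) {t : ℕ} (ht : 1 ≤ t) :
    Continuous fun x : P.X => P.g i t x := by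
  have hle : ∀ x ∈ P.X, ∀ y ∈ P.X, ∀ k, P.g i t x k - P.g i t y k ≤ G₂ * ‖x - y‖ := by
    intro x hx y hy k
    have h1 := hP.subgrad_g i t ht x hx y hy k
    have h2 : -(P.gradg i t x (y - x) k) ≤ G₂ * ‖x - y‖ := by
      rw [norm_sub_rev]
      calc -(P.gradg i t x (y - x) k) ≤ ‖P.gradg i t x (y - x) k‖ := neg_le_abs _
        _ ≤ ‖P.gradg i t x (y - x)‖ := PiLp.norm_apply_le _ k
        _ ≤ _ := (ContinuousLinearMap.le_opNorm _ _).trans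
          (mul_le_mul_of_nonneg_right (hP.gradg_le i t ht x hx) (norm_nonneg _))
    linarith
  have hk : ∀ k, Continuous fun x : P.X => P.g i t x k := fun k =>
    (LipschitzWith.of_dist_le_mul (K := Real.toNNReal G₂) fun x y => by
      rw [Real.dist_eq, Subtype.dist_eq, dist_eq_norm,
        Real.coe_toNNReal _ (hP.gradg_bound_nonneg i), abs_le]
      have h1 := hle x x.2 y y.2 k
      have h2 := hle y y.2 x x.2 k
      rw [norm_sub_rev] at h2
      exact ⟨by linarith, h1⟩).continuous
  exact (PiLp.continuous_toLp 2 fun _ : Fin (m i) => ℝ).comp (continuous_pi hk)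

theorem measurable_updateZ (hP : P.Regular R G₁ G₂ L) (α γ : ℕ → ℝ) (i : Fin n) {t : ℕ}
    (ht : 1 ≤ t) : Measurable fun x : P.X => Algorithm.updateZ P α γ t i x := by
  have hdual : Measurable fun x : P.X => Algorithm.dual P γ t i x :=
    ((continuous_orthantProj.comp (hP.continuous_g i ht)).const_smul (γ t)).measurable
  have hadj : Measurable fun x : P.X => ContinuousLinearMap.adjoint (P.gradg i t x) :=
    (LinearIsometryEquiv.continuous _).measurable.comp (hP.measurable_gradg i t ht)
  have hdir : Measurable fun x : P.X => Algorithm.direction P γ t i x :=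
    (hP.continuous_gradf i ht).measurable.add
      (ContinuousLinearMap.measurable_apply₂.comp (hadj.prodMk hdual))
  exact (continuous_proj hP.nonempty hP.convex hP.closed).measurable.comp
    (measurable_subtype_coe.sub (hdir.const_smul (α t)))

end OnlineProblem.Regular

namespace Algorithm

variable {n p : ℕ} {m : Fin n → ℕ} {P : OnlineProblem n p m} {N : Network n} {R G₁ G₂ L w : ℝ}
  {B : ℕ} {Ξ : Type*} {Q : Ξ → Vec p → Vec p} (α γ s : ℕ → ℝ) {z₁ : Fin n → Vec p}

theorem state_fst_mem (hP : P.Regular R G₁ G₂ L) (hz₁ : ∀ i, z₁ i ∈ P.X) (ξ : ℕ → Fin n → Ξ)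
    (t : ℕ) (i : Fin n) : (state P N α γ s Q z₁ ξ t).1 i ∈ P.X := by
  cases t with
  | zero => exact hz₁ i
  | succ t => exact proj_mem hP.nonempty hP.closed _

theorem state_snd_mem (hP : P.Regular R G₁ G₂ L) (ξ : ℕ → Fin n → Ξ) {t : ℕ} (ht : 1 ≤ t)
    (i : Fin n) : (state P N α γ s Q z₁ ξ t).2 i ∈ P.X := by
  obtain ⟨t, rfl⟩ := Nat.exists_eq_add_of_le' ht
  exact proj_mem hP.nonempty hP.closed _

theorem isTrajectory_state (hP : P.Regular R G₁ G₂ L) (hz₁ : ∀ i, z₁ i ∈ P.X)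
    (ξ : ℕ → Fin n → Ξ) :
    IsTrajectory P N α γ (fun t => (state P N α γ s Q z₁ ξ (t - 1)).1)
      (fun t => (state P N α γ s Q z₁ ξ t).2) (decision P N α γ s Q z₁ ξ) where
  z_mem t _ i := state_fst_mem α γ s hP hz₁ ξ (t - 1) i
  zh_mem t ht i := state_snd_mem α γ s hP ξ ht i
  x_eq _ _ _ := rfl
  z_succ t ht i := by
    obtain ⟨t, rfl⟩ := Nat.exists_eq_add_of_le' ht
    rfl

variable [MeasurableSpace Ξ]

/-- The iterates up to `t` are measurable for every σ-algebra that makes the randomness up to `t`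
measurable, in particular for the one that it generates. -/
theorem measurable_state (hP : P.Regular R G₁ G₂ L) (hN : N.Regular w B) (hw : 0 < w)
    (hQ : Measurable (Function.uncurry Q)) {Ω : Type*} [MeasurableSpace Ω] {ξ : ℕ → Fin n → Ω → Ξ}
    (t : ℕ) (hξ : ∀ r, 1 ≤ r → r ≤ t → ∀ i, Measurable (ξ r i)) (i : Fin n) :
    Measurable (fun ω => (state P N α γ s Q z₁ (fun t i => ξ t i ω) t).1 i) ∧
    Measurable (fun ω => (state P N α γ s Q z₁ (fun t i => ξ t i ω) t).2 i) := by
  induction t generalizing i with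
  | zero => exact ⟨measurable_const, measurable_const⟩
  | succ t ih =>
    have ih' := fun i => ih (fun r h1 h2 i => hξ r h1 (by lia) i) i
    have hzh : ∀ j, Measurable
        (fun ω => (state P N α γ s Q z₁ (fun t i => ξ t i ω) (t + 1)).2 j) := fun j =>
      (continuous_proj hP.nonempty hP.convex hP.closed).measurable.comp
        ((ih' j).2.add ((hQ.comp ((hξ (t + 1) (by lia) le_rfl j).prodMk
          (((ih' j).1.sub (ih' j).2).const_smul (s (t + 1))⁻¹))).const_smul (s (t + 1))))
    refine ⟨?_, hzh i⟩
    have hx : Measurable fun ω =>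
        select N (t + 1) (state P N α γ s Q z₁ (fun t i => ξ t i ω) (t + 1)).2 i :=
      Finset.measurable_sum _ fun j _ => (measurable_const_smul (N.W (t + 1) i j)).comp (hzh j)
    have hmem : ∀ ω, select N (t + 1) (state P N α γ s Q z₁ (fun t i => ξ t i ω) (t + 1)).2 i
        ∈ P.X := fun ω =>
      hP.convex.sum_mem (fun j _ => hN.weight_nonneg hw (by lia) i j)
        (hN.row_sum (t + 1) (by lia) i) fun j _ => state_snd_mem α γ s hP _ (by lia) j
    have hup := hP.measurable_updateZ α γ i (t := t + 1) (Nat.le_add_left 1 t)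
    have hsub : Measurable fun ω => (⟨_, hmem ω⟩ : P.X) := hx.subtype_mk
    have h := hup.comp hsub
    exact h

end Algorithm

/-! ### The expected compression error -/

theorem norm_sq_le_mul_ellNorm_sq {p : ℕ} {d : ℝ≥0∞} (hd : 1 ≤ d) (v : Vec p) :
    ‖v‖ ^ 2 ≤ p * ellNorm d v ^ 2 := by
  have : Fact (1 ≤ d) := ⟨hd⟩
  rw [EuclideanSpace.norm_sq_eq]
  calc ∑ k, ‖v k‖ ^ 2 ≤ ∑ _k : Fin p, ellNorm d v ^ 2 := Finset.sum_le_sum fun k _ =>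
        pow_le_pow_left₀ (norm_nonneg _)
          (PiLp.norm_apply_le (WithLp.toLp d fun k => v k : PiLp d fun _ : Fin p => ℝ) k) 2
    _ = _ := by simp

/-- The compression error keeps its bound at a random point that is independent of the randomness
of the compressor. -/
theorem IsCompressor.lintegral_error_le {p : ℕ} {Ω Ξ : Type*} [MeasurableSpace Ω]
    [MeasurableSpace Ξ] {μ : Measure Ω} [IsProbabilityMeasure μ] {ν : Measure Ξ}
    [IsProbabilityMeasure ν] {Q : Ξ → Vec p → Vec p} {d : ℝ≥0∞} {C : ℝ} (hd : 1 ≤ d)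
    (hQ : IsCompressor ν Q d C) {ζ : Ω → Ξ} (hζ : Measurable ζ) (hlaw : μ.map ζ = ν)
    {Y : Ω → Vec p} (hY : Measurable Y) (hind : IndepFun ζ Y μ) :
    ∫⁻ ω, ENNReal.ofReal (‖Q (ζ ω) (Y ω) - Y ω‖ ^ 2) ∂μ ≤ ENNReal.ofReal (p * C) := by
  have hφ : Measurable fun q : Ξ × Vec p => ENNReal.ofReal (‖Q q.1 q.2 - q.2‖ ^ 2) :=
    (((hQ.measurable.sub measurable_snd).norm).pow_const 2).ennreal_ofReal
  have hprod := (indepFun_iff_map_prod_eq_prod_map_map hζ.aemeasurable hY.aemeasurable).1 hind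
  have : IsProbabilityMeasure (μ.map Y) := Measure.isProbabilityMeasure_map hY.aemeasurable
  calc ∫⁻ ω, ENNReal.ofReal (‖Q (ζ ω) (Y ω) - Y ω‖ ^ 2) ∂μ
      = ∫⁻ q, ENNReal.ofReal (‖Q q.1 q.2 - q.2‖ ^ 2) ∂(μ.map fun ω => (ζ ω, Y ω)) :=
        (lintegral_map hφ (hζ.prodMk hY)).symm
    _ = ∫⁻ y, ∫⁻ a, ENNReal.ofReal (‖Q a y - y‖ ^ 2) ∂ν ∂(μ.map Y) := by
        rw [hprod, hlaw, lintegral_prod_symm _ hφ.aemeasurable]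
    _ ≤ ∫⁻ _y, ENNReal.ofReal (p * C) ∂(μ.map Y) := by
        refine lintegral_mono fun y => ?_
        calc ∫⁻ a, ENNReal.ofReal (‖Q a y - y‖ ^ 2) ∂ν
            ≤ ∫⁻ a, ENNReal.ofReal p * ENNReal.ofReal (ellNorm d (Q a y - y) ^ 2) ∂ν := by
              refine lintegral_mono fun a => ?_
              rw [← ENNReal.ofReal_mul (Nat.cast_nonneg p)]
              exact ENNReal.ofReal_le_ofReal (norm_sq_le_mul_ellNorm_sq hd _)
          _ ≤ ENNReal.ofReal (p * C) := by
              rw [lintegral_const_mul' _ _ ENNReal.ofReal_ne_top,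
                ENNReal.ofReal_mul (Nat.cast_nonneg p)]
              gcongr
              exact hQ.error_le y
    _ = _ := by simp

namespace Algorithm

variable {n p : ℕ} {m : Fin n → ℕ} {P : OnlineProblem n p m} {N : Network n} {R G₁ G₂ L w : ℝ}
  {B : ℕ} {Ω Ξ : Type*} [MeasurableSpace Ω] [MeasurableSpace Ξ] {μ : Measure Ω} {ν : Measure Ξ}
  {Q : Ξ → Vec p → Vec p} {ξ : ℕ → Fin n → Ω → Ξ} (α γ s : ℕ → ℝ) {z₁ : Fin n → Vec p}
  {d : ℝ≥0∞} {C : ℝ}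

theorem measurable_state_of_fresh (hP : P.Regular R G₁ G₂ L) (hN : N.Regular w B) (hw : 0 < w)
    (hQ : IsCompressor ν Q d C) (hξ : IsFreshRandomness μ ν ξ) (t : ℕ)
    (i : Fin n) :
    Measurable (fun ω => (state P N α γ s Q z₁ (fun t i => ξ t i ω) t).1 i) ∧
    Measurable (fun ω => (state P N α γ s Q z₁ (fun t i => ξ t i ω) t).2 i) :=
  measurable_state α γ s hP hN hw hQ.measurable t (fun r hr _ i => hξ.measurable r hr i) i

/-- The point compressed at iteration `t + 1` is independent of the randomness of that
compression. -/
theorem indepFun_state (hP : P.Regular R G₁ G₂ L) (hN : N.Regular w B) (hw : 0 < w)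
    (hQ : IsCompressor ν Q d C) (hξ : IsFreshRandomness μ ν ξ) (t : ℕ)
    (i : Fin n) (c : ℝ) :
    IndepFun (ξ (t + 1) i) (fun ω => c • ((state P N α γ s Q z₁ (fun t i => ξ t i ω) t).1 i
      - (state P N α γ s Q z₁ (fun t i => ξ t i ω) t).2 i)) μ := by
  have hind := hξ.indep (t + 1) (by lia) i
  rw [IndepFun_iff_Indep] at hind ⊢
  refine indep_of_indep_of_le_right hind ?_
  set past : Ω → (Set.Ico 1 (t + 1) × Fin n → Ξ) := fun ω q => ξ q.1 q.2 ω
  have hpast : ∀ r, 1 ≤ r → r ≤ t → ∀ i,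
      Measurable[MeasurableSpace.comap past MeasurableSpace.pi] (ξ r i) := by
    intro r h1 h2 i
    exact (measurable_pi_apply (⟨⟨r, h1, by lia⟩, i⟩ : Set.Ico 1 (t + 1) × Fin n)).comp
      (comap_measurable past)
  have h := @measurable_state n p m P N R G₁ G₂ L w B Ξ Q α γ s z₁ _ hP hN hw hQ.measurable
    Ω (MeasurableSpace.comap past MeasurableSpace.pi) ξ t hpast i
  exact Measurable.comap_le
    ((measurable_const_smul c).comp (h.1.sub h.2))

theorem integrable_error [IsProbabilityMeasure μ] (hP : P.Regular R G₁ G₂ L)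
    (hN : N.Regular w B) (hw : 0 < w) (hz₁ : ∀ i, z₁ i ∈ P.X) (hQ : IsCompressor ν Q d C)
    (hξ : IsFreshRandomness μ ν ξ) {t : ℕ} (ht : 1 ≤ t) (i : Fin n) :
    Integrable (fun ω => ‖(state P N α γ s Q z₁ (fun t i => ξ t i ω) t).2 i
      - (state P N α γ s Q z₁ (fun t i => ξ t i ω) (t - 1)).1 i‖) μ := by
  refine Integrable.of_bound (C := 2 * R)
    ((measurable_state_of_fresh α γ s hP hN hw hQ hξ t i).2.sub
      (measurable_state_of_fresh α γ s hP hN hw hQ hξ (t - 1) i).1).norm.aestronglyMeasurable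
    (Filter.Eventually.of_forall fun ω => ?_)
  rw [norm_norm]
  exact hP.norm_sub_le_two_mul (state_snd_mem α γ s hP _ ht i) (state_fst_mem α γ s hP hz₁ _ _ i)

/-- The projection is nonexpansive and fixes `z_{i,t}`, so the error is at most `s t` times the
error of the compressor. -/
theorem integral_error_le [IsProbabilityMeasure μ] [IsProbabilityMeasure ν]
    (hP : P.Regular R G₁ G₂ L) (hN : N.Regular w B) (hw : 0 < w) (hz₁ : ∀ i, z₁ i ∈ P.X)
    (hd : 1 ≤ d) (hC : 0 ≤ C) (hQ : IsCompressor ν Q d C) (hξ : IsFreshRandomness μ ν ξ) {t : ℕ}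
    (ht : 1 ≤ t) (hs : 0 < s t) (i : Fin n) :
    ∫ ω, ‖(state P N α γ s Q z₁ (fun t i => ξ t i ω) t).2 i
      - (state P N α γ s Q z₁ (fun t i => ξ t i ω) (t - 1)).1 i‖ ∂μ ≤ s t * (1 + p * C) := by
  have hint := integrable_error α γ s hP hN hw hz₁ hQ hξ ht i
  rw [← ENNReal.ofReal_le_ofReal_iff (by positivity),
    ofReal_integral_eq_lintegral_ofReal hint (Filter.Eventually.of_forall fun _ => norm_nonneg _)]
  obtain ⟨r, rfl⟩ := Nat.exists_eq_add_of_le' ht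
  rw [Nat.add_sub_cancel] at *
  set Y : Ω → Vec p := fun ω => (s (r + 1))⁻¹ •
    ((state P N α γ s Q z₁ (fun t i => ξ t i ω) r).1 i
      - (state P N α γ s Q z₁ (fun t i => ξ t i ω) r).2 i) with hY
  have hm := measurable_state_of_fresh (z₁ := z₁) α γ s hP hN hw hQ hξ r i
  have hYm : Measurable Y := (measurable_const_smul _).comp (hm.1.sub hm.2)
  have hE := hQ.lintegral_error_le hd (hξ.measurable (r + 1) ht i) (hξ.law (r + 1) ht i) hYm
    (indepFun_state α γ s hP hN hw hQ hξ r i _)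
  have hpt : ∀ ω, ‖(state P N α γ s Q z₁ (fun t i => ξ t i ω) (r + 1)).2 i
      - (state P N α γ s Q z₁ (fun t i => ξ t i ω) r).1 i‖
      ≤ s (r + 1) * (1 + ‖Q (ξ (r + 1) i ω) (Y ω) - Y ω‖ ^ 2) := by
    intro ω
    refine (norm_proj_sub_le hP.convex hP.closed _ (state_fst_mem α γ s hP hz₁ _ r i)).trans ?_
    have h1 : (state P N α γ s Q z₁ (fun t i => ξ t i ω) r).2 i
        + s (r + 1) • Q (ξ (r + 1) i ω) (Y ω)
        - (state P N α γ s Q z₁ (fun t i => ξ t i ω) r).1 i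
        = s (r + 1) • (Q (ξ (r + 1) i ω) (Y ω) - Y ω) := by
      rw [smul_sub, hY, smul_inv_smul₀ hs.ne']
      abel
    refine (le_of_eq (congrArg norm h1)).trans ?_
    rw [norm_smul, Real.norm_of_nonneg hs.le]
    refine mul_le_mul_of_nonneg_left ?_ hs.le
    nlinarith [sq_nonneg (‖Q (ξ (r + 1) i ω) (Y ω) - Y ω‖ - 1)]
  calc _ ≤ ∫⁻ ω, ENNReal.ofReal (s (r + 1))
        * (1 + ENNReal.ofReal (‖Q (ξ (r + 1) i ω) (Y ω) - Y ω‖ ^ 2)) ∂μ := by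
        refine lintegral_mono fun ω => ?_
        rw [← ENNReal.ofReal_one, ← ENNReal.ofReal_add zero_le_one (by positivity),
          ← ENNReal.ofReal_mul hs.le]
        exact ENNReal.ofReal_le_ofReal (hpt ω)
    _ = ENNReal.ofReal (s (r + 1))
        * (1 + ∫⁻ ω, ENNReal.ofReal (‖Q (ξ (r + 1) i ω) (Y ω) - Y ω‖ ^ 2) ∂μ) := by
        rw [lintegral_const_mul' _ _ ENNReal.ofReal_ne_top, lintegral_add_left measurable_const]
        simp
    _ ≤ ENNReal.ofReal (s (r + 1)) * (1 + ENNReal.ofReal (p * C)) := by gcongr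
    _ = _ := by
        rw [← ENNReal.ofReal_one, ← ENNReal.ofReal_add zero_le_one (by positivity),
          ← ENNReal.ofReal_mul hs.le]

/-! ### Integrability of the regret and of the violation -/

theorem integrable_comp_decision [IsProbabilityMeasure μ] (hP : P.Regular R G₁ G₂ L)
    (hN : N.Regular w B) (hw : 0 < w) (hz₁ : ∀ i, z₁ i ∈ P.X) (hQ : IsCompressor ν Q d C)
    (hξ : IsFreshRandomness μ ν ξ) {t : ℕ} (ht : 1 ≤ t) (i : Fin n) {E : Type*}
    [NormedAddCommGroup E] {F : Vec p → E} (hF : Continuous fun y : P.X => F y) :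
    Integrable (fun ω => F (decision P N α γ s Q z₁ (fun t i => ξ t i ω) i t)) μ := by
  have : CompactSpace P.X := isCompact_iff_compactSpace.1
    (Metric.isCompact_of_isClosed_isBounded hP.closed
      (isBounded_iff_forall_norm_le.2 ⟨R, hP.bounded⟩))
  have hx : Measurable fun ω => decision P N α γ s Q z₁ (fun t i => ξ t i ω) i t := by
    unfold decision select
    exact Finset.measurable_sum _ fun j _ => (measurable_const_smul (N.W t i j)).comp
      (measurable_state_of_fresh α γ s hP hN hw hQ hξ t j).2
  have hmem : ∀ ω, decision P N α γ s Q z₁ (fun t i => ξ t i ω) i t ∈ P.X := fun ω =>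
    (isTrajectory_state α γ s hP hz₁ (fun t i => ξ t i ω)).x_mem hP hN hw ht i
  obtain ⟨c, hc⟩ := isCompact_univ.exists_bound_of_continuousOn hF.continuousOn
  exact Integrable.of_bound (C := c)
    (hF.stronglyMeasurable.comp_measurable (hx.subtype_mk (h := hmem))).aestronglyMeasurable
    (Filter.Eventually.of_forall fun ω => hc ⟨_, hmem ω⟩ trivial)

end Algorithm

/-- The support function of a nonempty bounded set is Lipschitz. -/
theorem lipschitzWith_sInf_inner {p : ℕ} {S : Set (Vec p)} (hS : S.Nonempty) {R : ℝ}
    (hR : ∀ y ∈ S, ‖y‖ ≤ R) :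
    LipschitzWith (Real.toNNReal R) fun v => sInf ((fun y => inner ℝ v y) '' S) := by
  obtain ⟨y₀, hy₀⟩ := hS
  have hR0 : 0 ≤ R := (norm_nonneg _).trans (hR y₀ hy₀)
  have hle : ∀ u v : Vec p, sInf ((fun y => inner ℝ u y) '' S) - R * ‖u - v‖
      ≤ sInf ((fun y => inner ℝ v y) '' S) := by
    intro u v
    refine le_csInf (Set.Nonempty.image _ ⟨y₀, hy₀⟩) ?_
    rintro _ ⟨y, hy, rfl⟩
    have hb : BddBelow ((fun y => inner ℝ u y) '' S) := by
      refine ⟨-(‖u‖ * R), ?_⟩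
      rintro _ ⟨y, hy, rfl⟩
      exact (neg_le_neg ((abs_real_inner_le_norm u y).trans
        (mul_le_mul_of_nonneg_left (hR y hy) (norm_nonneg _)))).trans (neg_abs_le _)
    have h1 : sInf ((fun y => inner ℝ u y) '' S) ≤ inner ℝ u y := csInf_le hb ⟨y, hy, rfl⟩
    have h2 : inner ℝ u y - inner ℝ v y ≤ R * ‖u - v‖ := by
      rw [← inner_sub_left, mul_comm]
      exact (real_inner_le_norm _ _).trans (mul_le_mul_of_nonneg_left (hR y hy) (norm_nonneg _))
    linarith
  refine LipschitzWith.of_dist_le_mul fun u v => ?_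
  rw [Real.dist_eq, dist_eq_norm, Real.coe_toNNReal _ hR0, abs_le]
  have h1 := hle u v
  have h2 := hle v u
  rw [norm_sub_rev] at h2
  exact ⟨by linarith, by linarith⟩

namespace Algorithm

variable {n p : ℕ} {m : Fin n → ℕ} {P : OnlineProblem n p m} {N : Network n} {R G₁ G₂ L w : ℝ}
  {B : ℕ} {Ω Ξ : Type*} [MeasurableSpace Ω] [MeasurableSpace Ξ] {μ : Measure Ω}
  [IsProbabilityMeasure μ] {ν : Measure Ξ} {Q : Ξ → Vec p → Vec p} {ξ : ℕ → Fin n → Ω → Ξ}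
  (α γ s : ℕ → ℝ) {z₁ : Fin n → Vec p} {d : ℝ≥0∞} {C : ℝ}

theorem integrable_netReg (hP : P.Regular R G₁ G₂ L) (hN : N.Regular w B) (hw : 0 < w)
    (hz₁ : ∀ i, z₁ i ∈ P.X) (hQ : IsCompressor ν Q d C) (hξ : IsFreshRandomness μ ν ξ) {T : ℕ}
    (hT : 1 ≤ T) :
    Integrable (fun ω => P.netReg (decision P N α γ s Q z₁ fun t i => ξ t i ω) T) μ := by
  have hgrad : ∀ t, 1 ≤ t → Continuous fun y : P.X => P.globalGrad t y := fun t ht =>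
    (continuous_finsetSum _ fun j _ => hP.continuous_gradf j ht).const_smul (1 / (n : ℝ))
  refine (integrable_finsetSum _ fun i _ => Integrable.sub ?_ ?_).const_mul _
  · exact integrable_finsetSum _ fun t ht =>
      integrable_comp_decision α γ s hP hN hw hz₁ hQ hξ (Finset.mem_Icc.1 ht).1 i
        (F := fun y => inner ℝ (P.globalGrad t y) y)
        ((hgrad t (Finset.mem_Icc.1 ht).1).inner continuous_subtype_val)
  · have hlip := lipschitzWith_sInf_inner (hP.feasible T hT) fun y hy => hP.bounded y hy.1
    have hG : Integrable (fun ω => ∑ t ∈ Finset.Icc 1 T,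
        P.globalGrad t (decision P N α γ s Q z₁ (fun t i => ξ t i ω) i t)) μ :=
      integrable_finsetSum _ fun t ht =>
        integrable_comp_decision α γ s hP hN hw hz₁ hQ hξ (Finset.mem_Icc.1 ht).1 i
          (hgrad t (Finset.mem_Icc.1 ht).1)
    refine memLp_one_iff_integrable.1 (hlip.comp_memLp ?_ (memLp_one_iff_integrable.2 hG))
    simp [Set.Nonempty.image_const (hP.feasible T hT)]

theorem integrable_netCCV (hP : P.Regular R G₁ G₂ L) (hN : N.Regular w B) (hw : 0 < w)
    (hz₁ : ∀ i, z₁ i ∈ P.X) (hQ : IsCompressor ν Q d C) (hξ : IsFreshRandomness μ ν ξ) (T : ℕ) :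
    Integrable (fun ω => P.netCCV (decision P N α γ s Q z₁ fun t i => ξ t i ω) T) μ := by
  refine (integrable_finsetSum _ fun i _ => integrable_finsetSum _ fun t ht => ?_).const_mul _
  have ht1 := (Finset.mem_Icc.1 ht).1
  refine integrable_comp_decision α γ s hP hN hw hz₁ hQ hξ ht1 i
    (F := fun y => ‖orthantProj (P.globalConstraint t y)‖) (continuous_orthantProj.comp ?_).norm
  refine (PiLp.continuous_toLp 2 fun _ : (i : Fin n) × Fin (m i) => ℝ).comp
    (continuous_pi fun q => ?_)
  exact (EuclideanSpace.proj (𝕜 := ℝ) q.2).continuous.comp (hP.continuous_g q.1 ht1)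

end Algorithm

/-! ### Expectation of the bounds along trajectories -/

namespace Algorithm

variable {n p : ℕ} {m : Fin n → ℕ} {P : OnlineProblem n p m} {N : Network n} {R G₁ G₂ L w : ℝ}
  {B : ℕ} {Ω Ξ : Type*} [MeasurableSpace Ω] [MeasurableSpace Ξ] {μ : Measure Ω}
  [IsProbabilityMeasure μ] {ν : Measure Ξ} [IsProbabilityMeasure ν] {Q : Ξ → Vec p → Vec p}
  {ξ : ℕ → Fin n → Ω → Ξ} (α γ s : ℕ → ℝ) {z₁ : Fin n → Vec p} {d : ℝ≥0∞} {C : ℝ}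

/-- A bound that is affine in the compression errors passes to the expectation, where the error of
iteration `t` becomes at most `n * (s t * (1 + p * C))`. -/
theorem integral_le_of_le_totalError (hP : P.Regular R G₁ G₂ L) (hN : N.Regular w B) (hw : 0 < w)
    (hz₁ : ∀ i, z₁ i ∈ P.X) (hd : 1 ≤ d) (hC : 0 ≤ C) (hQ : IsCompressor ν Q d C)
    (hξ : IsFreshRandomness μ ν ξ) (hs : ∀ t, 1 ≤ t → 0 < s t) {T : ℕ} {F : Ω → ℝ}
    (hF : Integrable F μ) {b : ℕ → ℝ} (hb : ∀ t, 1 ≤ t → 0 ≤ b t) {c : ℝ}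
    (hle : ∀ ω, F ω ≤ c + ∑ t ∈ Finset.Icc 1 T,
      totalError (state P N α γ s Q z₁ (fun t i => ξ t i ω) (t - 1)).1
        (state P N α γ s Q z₁ (fun t i => ξ t i ω) t).2 * b t) :
    ∫ ω, F ω ∂μ ≤ c + ∑ t ∈ Finset.Icc 1 T, n * (s t * (1 + p * C)) * b t := by
  have hint : ∀ t ∈ Finset.Icc 1 T, Integrable (fun ω =>
      totalError (state P N α γ s Q z₁ (fun t i => ξ t i ω) (t - 1)).1
        (state P N α γ s Q z₁ (fun t i => ξ t i ω) t).2) μ := fun t ht =>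
    integrable_finsetSum _ fun i _ =>
      integrable_error α γ s hP hN hw hz₁ hQ hξ (Finset.mem_Icc.1 ht).1 i
  have hsum := integrable_finsetSum (Finset.Icc 1 T) fun t ht => (hint t ht).mul_const (b t)
  refine (integral_mono hF ((integrable_const c).add hsum) hle).trans ?_
  rw [integral_add' (integrable_const c) hsum, integral_const, integral_finsetSum _ fun t ht =>
    (hint t ht).mul_const (b t)]
  simp only [probReal_univ, one_smul]
  refine add_le_add_right (Finset.sum_le_sum fun t ht => ?_) c
  have ht1 := (Finset.mem_Icc.1 ht).1
  rw [integral_mul_const]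
  refine mul_le_mul_of_nonneg_right ?_ (hb t ht1)
  unfold totalError
  rw [integral_finsetSum _ fun i _ => integrable_error α γ s hP hN hw hz₁ hQ hξ ht1 i]
  refine (Finset.sum_le_sum fun i _ =>
    integral_error_le α γ s hP hN hw hz₁ hd hC hQ hξ ht1 (hs t ht1) i).trans (le_of_eq ?_)
  rw [Finset.sum_const, Finset.card_univ, Fintype.card_fin, nsmul_eq_mul]

end Algorithm

theorem powerSeq_eq_mul_rpow (a₀ θ : ℝ) (t : ℕ) : powerSeq a₀ θ t = a₀ * (t : ℝ) ^ (-θ) := by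
  rw [powerSeq, Real.rpow_neg (Nat.cast_nonneg t), div_eq_mul_inv]

theorem powerSeq_pos {a₀ : ℝ} (ha : 0 < a₀) (θ : ℝ) {t : ℕ} (ht : 1 ≤ t) : 0 < powerSeq a₀ θ t :=
  div_pos ha (Real.rpow_pos_of_pos (by exact_mod_cast ht) _)

theorem powerSeq_succ_le {a₀ θ : ℝ} (ha : 0 ≤ a₀) (hθ : 0 ≤ θ) {t : ℕ} (ht : 1 ≤ t) :
    powerSeq a₀ θ (t + 1) ≤ powerSeq a₀ θ t := by
  have : (0 : ℝ) < t := by exact_mod_cast ht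
  unfold powerSeq
  gcongr
  linarith

theorem powerSeq_le {a₀ θ : ℝ} (ha : 0 ≤ a₀) (hθ : 0 ≤ θ) {t : ℕ} (ht : 1 ≤ t) :
    powerSeq a₀ θ t ≤ a₀ :=
  div_le_self ha (Real.one_le_rpow (by exact_mod_cast ht) hθ)

theorem sum_powerSeq_le {a₀ θ : ℝ} (ha : 0 ≤ a₀) {η : ℝ} (hη0 : 0 ≤ η) (hη1 : η < 1) (hηθ : η ≤ θ)
    (T : ℕ) : ∑ t ∈ Finset.Icc 1 T, powerSeq a₀ θ t ≤ a₀ / (1 - η) * (T : ℝ) ^ (1 - η) := by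
  calc ∑ t ∈ Finset.Icc 1 T, powerSeq a₀ θ t
      ≤ ∑ t ∈ Finset.Icc 1 T, a₀ * (t : ℝ) ^ (-η) := by
        refine Finset.sum_le_sum fun t ht => ?_
        rw [powerSeq_eq_mul_rpow]
        exact mul_le_mul_of_nonneg_left (Real.rpow_le_rpow_of_exponent_le
          (by exact_mod_cast (Finset.mem_Icc.1 ht).1) (by linarith)) ha
    _ ≤ a₀ * ((T : ℝ) ^ (1 - η) / (1 - η)) := by
        rw [← Finset.mul_sum]
        exact mul_le_mul_of_nonneg_left (sum_rpow_neg_le hη0 hη1 T) ha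
    _ = _ := by ring

theorem powerSeq_div_powerSeq (a₀ b₀ θ η : ℝ) {t : ℕ} (ht : 1 ≤ t) :
    powerSeq a₀ θ t / powerSeq b₀ η t = powerSeq (a₀ / b₀) (θ - η) t := by
  have h0 : (0 : ℝ) < t := by exact_mod_cast ht
  have h1 := (Real.rpow_pos_of_pos h0 θ).ne'
  have h2 := (Real.rpow_pos_of_pos h0 η).ne'
  unfold powerSeq
  rw [Real.rpow_sub h0]
  field_simp

/-! ### The rates -/

theorem theorem1 (n p : ℕ) (hn : 0 < n) (R G₁ G₂ L : ℝ)
    (w : ℝ) (hw0 : 0 < w) (hw1 : w < 1) (B : ℕ) (hB : 0 < B)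
    (d : ℝ≥0∞) (hd : 1 ≤ d) (C : ℝ) (hC : 0 ≤ C)
    (α₀ γ₀ s₀ θ₁ θ₂ : ℝ) (hα₀ : 0 < α₀) (hγ₀ : 0 < γ₀) (hγ₀G₂ : γ₀ * (4 * G₂ ^ 2) ≤ 1)
    (hs₀ : 0 < s₀) (hθ₁0 : 0 < θ₁) (hθ₁1 : θ₁ < 1) (hθ₂ : θ₁ < θ₂) :
    ∃ (K : ℝ) (Ks : ℝ → ℝ),
      ∀ (m : Fin n → ℕ) (P : OnlineProblem n p m) (N : Network n)
        (Ω Ξ : Type*) [MeasurableSpace Ω] [MeasurableSpace Ξ]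
        (μ : Measure Ω) [IsProbabilityMeasure μ] (ν : Measure Ξ) [IsProbabilityMeasure ν]
        (Q : Ξ → Vec p → Vec p) (ξ : ℕ → Fin n → Ω → Ξ) (z₁ : Fin n → Vec p),
        P.Regular R G₁ G₂ L → N.Regular w B → IsCompressor ν Q d C →
        IsFreshRandomness μ ν ξ → (∀ i, z₁ i ∈ P.X) →
        let α : ℕ → ℝ := powerSeq α₀ θ₁
        let γ : ℕ → ℝ := fun t => γ₀ / α t
        let s : ℕ → ℝ := powerSeq s₀ θ₂
        let x : Ω → Fin n → ℕ → Vec p := fun ω =>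
          Algorithm.decision P N α γ s Q z₁ (fun t i => ξ t i ω)
        (∀ T : ℕ, 1 ≤ T →
          Integrable (fun ω => P.netReg (x ω) T) μ ∧
          Integrable (fun ω => P.netCCV (x ω) T) μ ∧
          (θ₂ < 1 → ∫ ω, P.netReg (x ω) T ∂μ ≤ K * (T : ℝ) ^ max (1 - θ₁) (1 + θ₁ - θ₂)) ∧
          (1 ≤ θ₂ → ∫ ω, P.netReg (x ω) T ∂μ ≤ K * (T : ℝ) ^ max (1 - θ₁) θ₁) ∧
          ∫ ω, P.netCCV (x ω) T ∂μ ≤ K * (T : ℝ) ^ (1 - θ₁ / 2)) ∧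
        (∀ ς : ℝ, 0 < ς → P.Slater ς → ∀ T : ℕ, 1 ≤ T →
          ∫ ω, P.netCCV (x ω) T ∂μ ≤ Ks ς * (T : ℝ) ^ (1 - θ₁)) := by
  obtain ⟨K₁, hK₁, hreg⟩ := exists_netReg_le (p := p) hn R G₁ G₂ L hw0 B hγ₀ hγ₀G₂ hα₀.le
  obtain ⟨K₂, hK₂, hccv⟩ := exists_netCCV_le_of_feasible (p := p) hn R G₁ G₂ L hw0 B hγ₀ hγ₀G₂ α₀
  choose! K₃ hK₃ hslater using fun (ς : ℝ) (hς : 0 < ς) =>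
    exists_netCCV_le_of_slater (p := p) hn R G₁ G₂ L hw0 B hγ₀ hγ₀G₂ α₀ hς
  set D : ℝ := n * (1 + p * C) with hD
  have hD0 : 0 ≤ D := by positivity
  have hθ : 0 < 1 - θ₁ := by linarith
  set c : ℝ := 1 + α₀ / (1 - θ₁) + D * (s₀ / (1 - θ₁)) with hc
  have hc0 : 0 ≤ c := by positivity
  set Kr₁ : ℝ := K₁ * (1 + 1 / α₀ + α₀ / (1 - θ₁) + D * (s₀ / α₀ / (1 - (θ₂ - θ₁))))
  set Kr₂ : ℝ := K₁ * (1 + 1 / α₀ + α₀ / (1 - θ₁) + D * (s₀ / α₀ / (1 - (1 - θ₁))))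
  refine ⟨max (max Kr₁ Kr₂) (K₂ * (1 + c)), fun ς => K₃ ς * c, ?_⟩
  intro m P N Ω Ξ _ _ μ _ ν _ Q ξ z₁ hP hN hQ hξ hz₁ α γ s x
  have hα : ∀ t, 1 ≤ t → 0 < α t := fun t ht => powerSeq_pos hα₀ θ₁ ht
  have hs : ∀ t, 1 ≤ t → 0 < s t := fun t ht => powerSeq_pos hs₀ θ₂ ht
  have hαa : ∀ t, 1 ≤ t → α t ≤ α₀ := fun t ht => powerSeq_le hα₀.le hθ₁0.le ht
  have hγ : ∀ t, 1 ≤ t → γ t = γ₀ / α t := fun _ _ => rfl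
  have hx : ∀ ω, IsTrajectory P N α γ _ _ (x ω) := fun ω =>
    Algorithm.isTrajectory_state (Q := Q) α γ s hP hz₁ fun t i => ξ t i ω
  have hA : ∀ T : ℕ, ∑ t ∈ Finset.Icc 1 T, α t ≤ α₀ / (1 - θ₁) * (T : ℝ) ^ (1 - θ₁) :=
    sum_powerSeq_le hα₀.le hθ₁0.le hθ₁1 le_rfl
  have hS : ∀ T : ℕ, ∑ t ∈ Finset.Icc 1 T, s t ≤ s₀ / (1 - θ₁) * (T : ℝ) ^ (1 - θ₁) :=
    sum_powerSeq_le hs₀.le hθ₁0.le hθ₁1 hθ₂.le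
  have hintR := fun T (hT : 1 ≤ T) =>
    Algorithm.integrable_netReg α γ s hP hN hw0 hz₁ hQ hξ hT
  have hintC := fun T => Algorithm.integrable_netCCV α γ s hP hN hw0 hz₁ hQ hξ T
  -- The expectation of an affine bound in the unweighted sum of the compression errors.
  have hexp : ∀ (T : ℕ), 1 ≤ T → ∀ (k c' : ℝ), 0 ≤ k →
      (∀ ω, P.netCCV (x ω) T ≤ c' + k * (1 + ∑ t ∈ Finset.Icc 1 T, α t
        + ∑ t ∈ Finset.Icc 1 T, totalError
          (Algorithm.state P N α γ s Q z₁ (fun t i => ξ t i ω) (t - 1)).1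
          (Algorithm.state P N α γ s Q z₁ (fun t i => ξ t i ω) t).2)) →
      ∫ ω, P.netCCV (x ω) T ∂μ ≤ c' + k * (c * (T : ℝ) ^ (1 - θ₁)) := by
    intro T hT k c' hk hle
    have h1 := Algorithm.integral_le_of_le_totalError α γ s hP hN hw0 hz₁ hd hC hQ hξ hs (T := T)
      (hintC T) (b := fun _ => k) (fun _ _ => hk)
      (c := c' + k * (1 + ∑ t ∈ Finset.Icc 1 T, α t)) fun ω => by
        rw [← Finset.sum_mul]
        linarith [hle ω]
    have h2 : ∑ t ∈ Finset.Icc 1 T, n * (s t * (1 + p * C)) * k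
        = k * (D * ∑ t ∈ Finset.Icc 1 T, s t) := by
      simp only [Finset.mul_sum]
      exact Finset.sum_congr rfl fun t _ => by rw [hD]; ring
    have hT1 : 1 ≤ (T : ℝ) ^ (1 - θ₁) := Real.one_le_rpow (by exact_mod_cast hT) hθ.le
    have h3 : 1 + ∑ t ∈ Finset.Icc 1 T, α t + D * ∑ t ∈ Finset.Icc 1 T, s t
        ≤ c * (T : ℝ) ^ (1 - θ₁) := by
      have h4 := mul_le_mul_of_nonneg_left (hS T) hD0
      have h5 := hA T
      rw [hc]
      linarith
    have h4 := mul_le_mul_of_nonneg_left h3 hk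
    rw [h2] at h1
    linarith
  -- The expected regret, up to the power sum of the weighted compression errors.
  have hregE : ∀ (T : ℕ), 1 ≤ T → ∀ M η : ℝ, 0 ≤ M → 1 - θ₁ ≤ M → θ₁ ≤ M → 0 ≤ η → η < 1 →
      η ≤ θ₂ - θ₁ → 1 - η ≤ M → ∫ ω, P.netReg (x ω) T ∂μ
        ≤ K₁ * (1 + 1 / α₀ + α₀ / (1 - θ₁) + D * (s₀ / α₀ / (1 - η))) * (T : ℝ) ^ M := by
    intro T hT M η hM0 hM1 hM2 hη0 hη1 hη2 hηM
    have hT1 : (1 : ℝ) ≤ T := by exact_mod_cast hT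
    have hmono : ∀ r, r ≤ M → (T : ℝ) ^ r ≤ (T : ℝ) ^ M := fun r hr =>
      Real.rpow_le_rpow_of_exponent_le hT1 hr
    have h1 := Algorithm.integral_le_of_le_totalError α γ s hP hN hw0 hz₁ hd hC hQ hξ hs (T := T)
      (hintR T hT) (b := fun t => K₁ * (1 / α t))
      (fun t ht => mul_nonneg hK₁ (one_div_nonneg.2 (hα t ht).le))
      (c := K₁ * (1 + 1 / α T + ∑ t ∈ Finset.Icc 1 T, α t)) fun ω => by
        refine (hreg m P N α γ _ _ (x ω) hP hN (hx ω) hα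
          (fun t ht => powerSeq_succ_le hα₀.le hθ₁0.le ht) hαa hγ T hT).trans (le_of_eq ?_)
        rw [mul_add K₁ _ (Finset.sum _ _)]
        congr 1
        rw [Finset.mul_sum]
        exact Finset.sum_congr rfl fun t _ => by ring
    have h2 : ∑ t ∈ Finset.Icc 1 T, n * (s t * (1 + p * C)) * (K₁ * (1 / α t))
        = K₁ * (D * ∑ t ∈ Finset.Icc 1 T, powerSeq (s₀ / α₀) (θ₂ - θ₁) t) := by
      simp only [Finset.mul_sum]
      refine Finset.sum_congr rfl fun t ht => ?_
      rw [← powerSeq_div_powerSeq s₀ α₀ θ₂ θ₁ (Finset.mem_Icc.1 ht).1, hD]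
      simp only [s, α]
      ring
    have h3 := mul_le_mul_of_nonneg_left ((sum_powerSeq_le (θ := θ₂ - θ₁)
      (show 0 ≤ s₀ / α₀ by positivity) hη0 hη1 hη2 T).trans (mul_le_mul_of_nonneg_left
        (hmono _ hηM) (div_nonneg (by positivity) (by linarith)))) hD0
    have h4 := (hA T).trans (mul_le_mul_of_nonneg_left (hmono _ hM1) (by positivity))
    have h5 : 1 / α T ≤ 1 / α₀ * (T : ℝ) ^ M := by
      have : 1 / α T = 1 / α₀ * (T : ℝ) ^ θ₁ := by simp only [α, powerSeq]; field_simp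
      rw [this]
      exact mul_le_mul_of_nonneg_left (hmono _ hM2) (by positivity)
    have h6 : 1 ≤ (T : ℝ) ^ M := Real.one_le_rpow hT1 hM0
    rw [h2, ← mul_add] at h1
    refine h1.trans ?_
    rw [mul_assoc K₁]
    refine mul_le_mul_of_nonneg_left ?_ hK₁
    linarith
  refine ⟨fun T hT => ⟨hintR T hT, hintC T, fun hθ₂1 => ?_, fun hθ₂1 => ?_, ?_⟩,
    fun ς hς hsl T hT => ?_⟩
  · refine (hregE T hT (max (1 - θ₁) (1 + θ₁ - θ₂)) (θ₂ - θ₁) ?_ ?_ ?_ ?_ ?_ ?_ ?_).trans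
      (mul_le_mul_of_nonneg_right ((le_max_left _ _).trans (le_max_left _ _)) (by positivity))
    · exact hθ.le.trans (le_max_left _ _)
    · exact le_max_left _ _
    · exact le_trans (by linarith) (le_max_right _ _)
    · linarith
    · linarith
    · exact le_rfl
    · exact le_trans (by linarith) (le_max_right _ _)
  · refine (hregE T hT (max (1 - θ₁) θ₁) (1 - θ₁) ?_ ?_ ?_ ?_ ?_ ?_ ?_).trans
      (mul_le_mul_of_nonneg_right ((le_max_right _ _).trans (le_max_left _ _)) (by positivity))
    · exact hθ.le.trans (le_max_left _ _)
    · exact le_max_left _ _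
    · exact le_max_right _ _
    · exact hθ.le
    · linarith
    · linarith
    · exact le_trans (by linarith) (le_max_right _ _)
  · -- The parameter `τ = T ^ (θ₁ / 2)` balances `T / τ` and `τ * T ^ (1 - θ₁)`.
    have hT0 : (0 : ℝ) < T := by exact_mod_cast hT
    have hT1 : (1 : ℝ) ≤ T := by exact_mod_cast hT
    have hτ : 1 ≤ (T : ℝ) ^ (θ₁ / 2) := Real.one_le_rpow hT1 (by linarith)
    have h1 := hexp T hT (K₂ * (T : ℝ) ^ (θ₁ / 2)) (K₂ * (T / (T : ℝ) ^ (θ₁ / 2)))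
      (by positivity) fun ω => by
        have := hccv m P N α γ _ _ (x ω) hP hN (hx ω) hα hαa hγ T hT _ hτ
        rwa [mul_add, ← mul_assoc K₂ ((T : ℝ) ^ (θ₁ / 2))] at this
    have h2 : (T : ℝ) / (T : ℝ) ^ (θ₁ / 2) = (T : ℝ) ^ (1 - θ₁ / 2) := by
      rw [Real.rpow_sub hT0, Real.rpow_one]
    have h3 : (T : ℝ) ^ (θ₁ / 2) * (T : ℝ) ^ (1 - θ₁) = (T : ℝ) ^ (1 - θ₁ / 2) := by
      rw [← Real.rpow_add hT0]; congr 1; ring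
    refine h1.trans (le_trans (le_of_eq ?_)
      (mul_le_mul_of_nonneg_right (le_max_right _ _) (by positivity)))
    rw [h2]
    linear_combination K₂ * c * h3
  · have h1 := hexp T hT (K₃ ς) 0 (hK₃ ς hς) fun ω => by
      rw [zero_add]
      exact hslater ς hς m P N α γ _ _ (x ω) hP hN (hx ω) hα hαa hγ hsl T
    rw [zero_add, ← mul_assoc] at h1
    exact h1
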